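/- Let $Y$ be a smooth manifold of dimension $k+1$ and let $\iota\colon Y\to\mathbb{H}^{n+1}(-1)$ be a smooth immersion into hyperbolic space, realised as the open unit ball of $\mathbb{R}^{n+1}$ with the metric $g_H=\left(\frac{2}{1-|x|^2}\right)^2\sum_i dx_i^2$. Give $Y$ the induced metric $h=\iota^*g_H$ and assume that $(Y,h)$ is complete and noncompact. Let $H$ be the mean curvature vector of $\iota$, that is, the trace with respect to $h$ (not divided by the dimension) of the second fundamental form. If there is a constant $\alpha<k$ such that $|H|\le\alpha$ everywhere on $Y$, then $$\left(\frac{k-\alpha}{2}\right)^2\le\lambda_{1,2}(Y).$$ Here $$\lambda_{1,2}(Y)=\inf_{\Omega}\ \inf_{0\neq f\in W^{1,2}_0(\Omega)}\frac{\int_\Omega|\nabla f|^2\,dv_h}{\int_\Omega f^2\,dv_h},$$ where $\Omega$ ranges over the bounded domains of $Y$ with smooth boundary and $W^{1,2}_0(\Omega)$ is the completion of $C^\infty_0(\Omega)$ in the Sobolev norm $\left(\int_\Omega f^2+|\nabla f|^2\,dv_h\right)^{1/2}$. -/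

import Mathlib

open Set Filter Topology MeasureTheory Manifold Bundle
open scoped ContDiff ENNReal InnerProductSpace

noncomputable section

section RiemannianManifold

/-! ### Volume and first Dirichlet eigenvalue of a Riemannian manifold of dimension `m` -/

variable {m : ℕ} {M : Type*} [EMetricSpace M]
  [ChartedSpace (EuclideanSpace ℝ (Fin m)) M]
  [RiemannianBundle (fun x : M ↦ TangentSpace (𝓡 m) x)]

/-- The coordinate vector field `∂ᵢ` of the chart `e`, at the point with coordinates `x`. -/
def coordVector (e : OpenPartialHomeomorph M (EuclideanSpace ℝ (Fin m)))
    (x : EuclideanSpace ℝ (Fin m)) (i : Fin m) : TangentSpace (𝓡 m) (e.symm x) :=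
  mfderiv (𝓡 m) (𝓡 m) e.symm x (EuclideanSpace.single i (1 : ℝ))

/-- The matrix `(gᵢⱼ)` of the Riemannian metric in the chart `e`. -/
def chartGram (e : OpenPartialHomeomorph M (EuclideanSpace ℝ (Fin m)))
    (x : EuclideanSpace ℝ (Fin m)) : Matrix (Fin m) (Fin m) ℝ :=
  Matrix.of fun i j ↦ ⟪coordVector e x i, coordVector e x j⟫_ℝ

variable [MeasurableSpace M]

/-- The measure `√(det gᵢⱼ) dx` of the chart `e`, carried to the source of `e` in `M`. -/
def chartVolume (e : OpenPartialHomeomorph M (EuclideanSpace ℝ (Fin m))) : Measure M :=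
  (((volume : Measure (EuclideanSpace ℝ (Fin m))).restrict e.target).withDensity
    fun x ↦ ENNReal.ofReal (√(chartGram e x).det)).map e.symm

variable (m M) in
/-- The Riemannian volume measure: the least measure that dominates `√(det gᵢⱼ) dx` in every chart.
These measures agree on overlaps (change of variables), so that the least upper bound restricts
to `√(det gᵢⱼ) dx` on the domain of each chart. -/
def riemannianVolume : Measure M :=
  ⨆ e ∈ atlas (EuclideanSpace ℝ (Fin m)) M, chartVolume e

variable (m) in
/-- A bounded domain with smooth boundary: near each of its boundary points it is a sublevel set
`{ρ < 0}` of a smooth function with nonvanishing differential. -/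
structure IsSmoothBoundedDomain (Ω : Set M) : Prop where
  isOpen : IsOpen Ω
  isConnected : IsConnected Ω
  bounded : Metric.ediam Ω ≠ ⊤
  smooth_boundary : ∀ p ∈ frontier Ω, ∃ (U : Set M) (ρ : M → ℝ), IsOpen U ∧ p ∈ U ∧
    ContMDiffOn (𝓡 m) 𝓘(ℝ, ℝ) ∞ ρ U ∧ mfderiv (𝓡 m) 𝓘(ℝ, ℝ) ρ p ≠ 0 ∧
    Ω ∩ U = {y ∈ U | ρ y < 0}

variable (m) in
/-- The differential `dφ` of a function, as a field of covectors. Its pointwise operator norm for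
the Riemannian metric is `|∇φ|`. -/
def differential (φ : M → ℝ) (y : M) : TangentSpace (𝓡 m) y →L[ℝ] ℝ :=
  mfderiv (𝓡 m) 𝓘(ℝ, ℝ) φ y

variable (m) in
/-- Smooth functions with compact support in `Ω`. -/
structure IsTestFunction (Ω : Set M) (φ : M → ℝ) : Prop where
  smooth : ContMDiff (𝓡 m) 𝓘(ℝ, ℝ) ∞ φ
  hasCompactSupport : HasCompactSupport φ
  tsupport_subset : tsupport φ ⊆ Ω

/-- A covector field `G` on `Ω` is measurable when all the functions `|dφ - G|` with `φ` smooth are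
(by polarization, this says that all the inner products of `G` with differentials of smooth
functions, hence the components of `G` in charts, are measurable). -/
def IsMeasurableCovectorField (Ω : Set M) (G : ∀ y : M, TangentSpace (𝓡 m) y →L[ℝ] ℝ) : Prop :=
  ∀ φ : M → ℝ, ContMDiff (𝓡 m) 𝓘(ℝ, ℝ) ∞ φ →
    AEMeasurable (fun y ↦ ‖differential m φ y - G y‖) ((riemannianVolume m M).restrict Ω)

/-- `f` belongs to `W₀^{1,2}(Ω)`, the completion of the smooth functions with compact support
in `Ω` for the Sobolev norm `(∫ |φ|² + |∇φ|²)^{1/2}`, and `G` is its weak differential. -/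
structure IsSobolevZero (Ω : Set M) (f : M → ℝ)
    (G : ∀ y : M, TangentSpace (𝓡 m) y →L[ℝ] ℝ) : Prop where
  memLp : MemLp f 2 ((riemannianVolume m M).restrict Ω)
  measurable : IsMeasurableCovectorField Ω G
  approx : ∃ φ : ℕ → M → ℝ, (∀ j, IsTestFunction m Ω (φ j)) ∧
    Tendsto (fun j ↦ (∫⁻ y in Ω, ‖φ j y - f y‖ₑ ^ 2 ∂(riemannianVolume m M)) +
      ∫⁻ y in Ω, ‖differential m (φ j) y - G y‖ₑ ^ 2 ∂(riemannianVolume m M)) atTop (𝓝 0)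

variable (m) in
/-- The first Dirichlet eigenvalue `λ_{1,2}(Ω)`, as the infimum of Rayleigh quotients over the
nonzero elements of `W₀^{1,2}(Ω)`. -/
def dirichletEigenvalueOn (Ω : Set M) : ℝ≥0∞ :=
  ⨅ (f : M → ℝ) (G : ∀ y : M, TangentSpace (𝓡 m) y →L[ℝ] ℝ) (_ : IsSobolevZero Ω f G)
    (_ : ¬ f =ᵐ[(riemannianVolume m M).restrict Ω] 0),
    (∫⁻ y in Ω, ‖G y‖ₑ ^ 2 ∂(riemannianVolume m M)) /
      ∫⁻ y in Ω, ‖f y‖ₑ ^ 2 ∂(riemannianVolume m M)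

variable (m M) in
/-- The first Dirichlet eigenvalue `λ_{1,2}(M)`: the infimum of `λ_{1,2}(Ω)` over the bounded
domains `Ω` of `M` with smooth boundary. -/
def firstDirichletEigenvalue : ℝ≥0∞ :=
  ⨅ (Ω : Set M) (_ : IsSmoothBoundedDomain m Ω), dirichletEigenvalueOn m Ω

end RiemannianManifold

section HyperbolicSpace

/-! ### Hyperbolic space `ℍᵈ(-1)`: the open unit ball of `ℝᵈ` with the Poincaré metric -/

variable {d : ℕ}

/-- The Poincaré metric `(2 / (1 - |x|²))² ∑ dxᵢ²` at the point `x` of the unit ball. -/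
def hypInner (x v w : EuclideanSpace ℝ (Fin d)) : ℝ :=
  (2 / (1 - ‖x‖ ^ 2)) ^ 2 * ⟪v, w⟫_ℝ

/-- The length of the vector `v` at `x` for the Poincaré metric. -/
def hypNorm (x v : EuclideanSpace ℝ (Fin d)) : ℝ :=
  √(hypInner x v v)

/-- The Christoffel symbol `Γ_x(v, w)` of the Poincaré metric: its Levi-Civita connection is
`∇_V W = D_V W + Γ(V, W)`, where `D` is the flat connection of `ℝᵈ`. -/
def hypChristoffel (x v w : EuclideanSpace ℝ (Fin d)) : EuclideanSpace ℝ (Fin d) :=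
  (2 / (1 - ‖x‖ ^ 2)) • (⟪x, v⟫_ℝ • w + ⟪x, w⟫_ℝ • v - ⟪v, w⟫_ℝ • x)

/-- The connection with symbol `hypChristoffel` is torsion-free. -/
theorem hypChristoffel_symm (x v w : EuclideanSpace ℝ (Fin d)) :
    hypChristoffel x v w = hypChristoffel x w v := by
  simp only [hypChristoffel, real_inner_comm v w]
  congr 2
  abel

/-- The connection with symbol `hypChristoffel` is compatible with the Poincaré metric. -/
theorem hasDerivAt_hypInner {x : EuclideanSpace ℝ (Fin d)} (hx : ‖x‖ < 1)
    (u v w : EuclideanSpace ℝ (Fin d)) :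
    HasDerivAt (fun t : ℝ ↦ hypInner (x + t • u) v w)
      (hypInner x (hypChristoffel x u v) w + hypInner x v (hypChristoffel x u w)) 0 := by
  have hpos : 1 - ‖x‖ ^ 2 ≠ 0 := by nlinarith [norm_nonneg x]
  have hline : HasDerivAt (fun t : ℝ ↦ x + t • u) u 0 := by
    simpa using ((hasDerivAt_id (0 : ℝ)).smul_const u).const_add x
  have hn : HasDerivAt (fun t : ℝ ↦ ‖x + t • u‖ ^ 2) (2 * ⟪x, u⟫_ℝ) 0 := by
    simpa using hline.norm_sq
  have h := ((((hn.const_sub 1).fun_inv (by simpa using hpos)).const_mul 2).fun_pow 2).mul_const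
    ⟪v, w⟫_ℝ
  simp only [hypInner, hypChristoffel, div_eq_mul_inv]
  refine h.congr_deriv ?_
  simp only [real_inner_smul_left, real_inner_smul_right, inner_add_left, inner_add_right,
    inner_sub_left, inner_sub_right, zero_smul, add_zero]
  rw [real_inner_comm x v, real_inner_comm u v]
  push_cast
  field_simp
  ring

end HyperbolicSpace

section Submanifold

/-! ### Second fundamental form and mean curvature of a submanifold of hyperbolic space -/

variable {m d : ℕ} {Y : Type*} [EMetricSpace Y]
  [ChartedSpace (EuclideanSpace ℝ (Fin m)) Y]

/-- The differential of `ι` at `y`, with values in `ℝᵈ`. -/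
def pushforward (ι : Y → EuclideanSpace ℝ (Fin d)) (y : Y) :
    TangentSpace (𝓡 m) y →L[ℝ] EuclideanSpace ℝ (Fin d) :=
  mfderiv (𝓡 m) (𝓡 d) ι y

/-- The normal space of the submanifold at `y`. Orthogonality for the Poincaré metric and for the
Euclidean inner product are the same thing, since the two are proportional. -/
def normalSpace (ι : Y → EuclideanSpace ℝ (Fin d)) (y : Y) :
    Submodule ℝ (EuclideanSpace ℝ (Fin d)) :=
  ((pushforward (m := m) ι y).toLinearMap.range)ᗮ

/-- The second fundamental form `II(v, w) = (∇_v dι(w))^⊥` of `ι` at `y`, where `∇` is the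
Levi-Civita connection of hyperbolic space. It is computed in the preferred chart at `y`, which
identifies the tangent space of `Y` at `y` with `ℝᵐ`: with `F = ι ∘ (chart)⁻¹` it is the normal part
of `D²F(v, w) + Γ(DF v, DF w)`. -/
def secondFundamentalForm (ι : Y → EuclideanSpace ℝ (Fin d)) (y : Y)
    (v w : TangentSpace (𝓡 m) y) : EuclideanSpace ℝ (Fin d) :=
  (normalSpace (m := m) ι y).starProjection
    (fderiv ℝ (fderiv ℝ (ι ∘ (extChartAt (𝓡 m) y).symm)) (extChartAt (𝓡 m) y y) v w +
      hypChristoffel (ι y) (pushforward ι y v) (pushforward ι y w))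

variable [RiemannianBundle (fun y : Y ↦ TangentSpace (𝓡 m) y)]

variable (m) in
/-- `ι : Y → ℍᵈ(-1)` is a smooth immersion and the Riemannian metric of `Y` is the induced one. -/
structure IsIsometricImmersion (ι : Y → EuclideanSpace ℝ (Fin d)) : Prop where
  mem_ball : ∀ y, ‖ι y‖ < 1
  smooth : ContMDiff (𝓡 m) (𝓡 d) ∞ ι
  injective : ∀ y, Function.Injective (pushforward (m := m) ι y)
  inner_eq : ∀ (y : Y) (v w : TangentSpace (𝓡 m) y),
    ⟪v, w⟫_ℝ = hypInner (ι y) (pushforward ι y v) (pushforward ι y w)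

variable (m) in
/-- The mean curvature vector at `y`: the trace of the second fundamental form (not divided by the
dimension), taken in an orthonormal basis of the tangent space of `Y` at `y`. -/
def meanCurvature (ι : Y → EuclideanSpace ℝ (Fin d)) (y : Y) : EuclideanSpace ℝ (Fin d) :=
  letI : FiniteDimensional ℝ (TangentSpace (𝓡 m) y) :=
    inferInstanceAs (FiniteDimensional ℝ (EuclideanSpace ℝ (Fin m)))
  ∑ i, secondFundamentalForm ι y (stdOrthonormalBasis ℝ (TangentSpace (𝓡 m) y) i)
    (stdOrthonormalBasis ℝ (TangentSpace (𝓡 m) y) i)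

end Submanifold

end

/-!
The proof tests the Rayleigh quotient with a vector field of large divergence (the argument of
McKean, Cheung and Leung). Let `r` be the hyperbolic distance to the origin of the ball. The
function `f = log (cosh r)` is smooth on all of hyperbolic space, its gradient `V` (`radialField`)
satisfies `|V| ≤ 1`, and `Hess f = g - df ⊗ df`, that is `∇_u V = u - ⟨V, u⟩ V`
(`fderiv_radialField_add_hypChristoffel`). Let `X` be the tangential part of `V` along the
immersion of `Y`, with `dim Y = m = k + 1`. Tracing over the tangent space,

`div X = m - |X|² + ⟨V^⊥, H⟩ ≥ m - 1 - α = k - α`,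

which is `IsHypImmersionOn.le_divergence_tangentialField`. For a smooth `φ` with compact support,
the divergence theorem for `φ² X` and `|X| ≤ 1` give

`(k - α) ∫ φ² ≤ -2 ∫ φ dφ(X) ≤ c ∫ φ² + c⁻¹ ∫ |dφ|²`, with `c = (k - α) / 2`,

hence `c² ∫ φ² ≤ ∫ |dφ|²` (`IsIsometricImmersion.ofReal_mul_lintegral_sq_le`), and this inequality
passes to the Sobolev completion (`IsSobolevZero.mul_lintegral_sq_le`).

The divergence is computed in charts. At a point `x` of a chart, everything is expressed in a
basis of constant coordinate vectors that is orthonormal for the induced metric at `x`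
(`IsInducedFrame`): the derivative of the volume density is a trace, because the differential of
the determinant at the identity is one, and the Christoffel terms cancel by the symmetry of the
covariant Hessian. The normal part of the trace of this Hessian is the mean curvature vector in
any chart (`IsIsometricImmersion.exists_isInducedFrame`), since a change of coordinates alters the
Hessian by tangential terms only. The change of variables formula shows that the chart measures
agree on overlaps, so that the Riemannian volume is `√(det gᵢⱼ) dx` in each chart
(`IsIsometricImmersion.riemannianVolume_restrict_source`), and a partition of unity globalizes the
divergence theorem.
-/

/-! ### The Poincaré metric and the radial field -/

section PoincareMetric

variable {d : ℕ}

theorem one_sub_norm_sq_pos {x : EuclideanSpace ℝ (Fin d)} (hx : ‖x‖ < 1) : 0 < 1 - ‖x‖ ^ 2 := by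
  nlinarith [norm_nonneg x]

theorem hypInner_comm (x v w : EuclideanSpace ℝ (Fin d)) : hypInner x v w = hypInner x w v := by
  simp only [hypInner, real_inner_comm]

theorem hypInner_add_left (x u v w : EuclideanSpace ℝ (Fin d)) :
    hypInner x (u + v) w = hypInner x u w + hypInner x v w := by
  simp only [hypInner, inner_add_left]; ring

theorem hypInner_sub_left (x u v w : EuclideanSpace ℝ (Fin d)) :
    hypInner x (u - v) w = hypInner x u w - hypInner x v w := by
  simp only [hypInner, inner_sub_left]; ring

theorem hypInner_smul_left (x v w : EuclideanSpace ℝ (Fin d)) (c : ℝ) :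
    hypInner x (c • v) w = c * hypInner x v w := by
  simp only [hypInner, real_inner_smul_left]; ring

theorem hypInner_sum_left {κ : Type*} (s : Finset κ) (x v : EuclideanSpace ℝ (Fin d))
    (w : κ → EuclideanSpace ℝ (Fin d)) :
    hypInner x (∑ a ∈ s, w a) v = ∑ a ∈ s, hypInner x (w a) v := by
  simp only [hypInner, sum_inner, Finset.mul_sum]

theorem hypInner_self_nonneg (x v : EuclideanSpace ℝ (Fin d)) : 0 ≤ hypInner x v v :=
  mul_nonneg (sq_nonneg _) real_inner_self_nonneg

theorem hypInner_self_pos {x v : EuclideanSpace ℝ (Fin d)} (hx : ‖x‖ < 1) (hv : v ≠ 0) :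
    0 < hypInner x v v :=
  mul_pos (pow_pos (div_pos two_pos (one_sub_norm_sq_pos hx)) 2) (real_inner_self_pos.2 hv)

theorem abs_hypInner_le (x v w : EuclideanSpace ℝ (Fin d)) :
    |hypInner x v w| ≤ hypNorm x v * hypNorm x w := by
  have key : ∀ u : EuclideanSpace ℝ (Fin d), hypNorm x u = |2 / (1 - ‖x‖ ^ 2)| * ‖u‖ := fun u ↦ by
    rw [hypNorm, hypInner, real_inner_self_eq_norm_sq, ← mul_pow, Real.sqrt_sq_eq_abs, abs_mul,
      abs_norm]
  rw [key, key, hypInner, abs_mul, abs_pow]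
  have := abs_real_inner_le_norm v w
  calc |2 / (1 - ‖x‖ ^ 2)| ^ 2 * |⟪v, w⟫_ℝ| ≤ |2 / (1 - ‖x‖ ^ 2)| ^ 2 * (‖v‖ * ‖w‖) := by gcongr
    _ = _ := by ring

/-- The gradient for the Poincaré metric of `log (cosh r)`, where `r` is the hyperbolic distance to
the origin: `cosh r = (1 + |x|²) / (1 - |x|²)`. -/
noncomputable def radialField (x : EuclideanSpace ℝ (Fin d)) : EuclideanSpace ℝ (Fin d) :=
  ((1 - ‖x‖ ^ 2) / (1 + ‖x‖ ^ 2)) • x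

theorem contDiff_radialField {n : WithTop ℕ∞} :
    ContDiff ℝ n (radialField : EuclideanSpace ℝ (Fin d) → EuclideanSpace ℝ (Fin d)) := by
  have h : ContDiff ℝ n fun x : EuclideanSpace ℝ (Fin d) ↦ (1 - ‖x‖ ^ 2) / (1 + ‖x‖ ^ 2) :=
    (contDiff_const.sub (contDiff_norm_sq ℝ)).div (contDiff_const.add (contDiff_norm_sq ℝ))
      fun x ↦ by positivity
  exact h.smul contDiff_id

theorem hypInner_radialField_self_le_one {x : EuclideanSpace ℝ (Fin d)} (hx : ‖x‖ < 1) :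
    hypInner x (radialField x) (radialField x) ≤ 1 := by
  have h1 := one_sub_norm_sq_pos hx
  have h2 : 0 < 1 + ‖x‖ ^ 2 := by positivity
  have : hypInner x (radialField x) (radialField x) = 4 * ‖x‖ ^ 2 / (1 + ‖x‖ ^ 2) ^ 2 := by
    rw [hypInner, radialField, real_inner_smul_left, real_inner_smul_right,
      real_inner_self_eq_norm_sq]
    field_simp
    ring
  rw [this, div_le_one (by positivity)]
  nlinarith [sq_nonneg (1 - ‖x‖ ^ 2)]

/-- The Hessian of `f = log (cosh r)` is `g - df ⊗ df`: the covariant derivative of its gradient `V`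
is `∇_u V = u - ⟨V, u⟩ V`. -/
theorem fderiv_radialField_add_hypChristoffel {x : EuclideanSpace ℝ (Fin d)} (hx : ‖x‖ < 1)
    (u : EuclideanSpace ℝ (Fin d)) :
    fderiv ℝ radialField x u + hypChristoffel x u (radialField x) =
      u - hypInner x (radialField x) u • radialField x := by
  have h1 := (one_sub_norm_sq_pos hx).ne'
  have h2 : 1 + ‖x‖ ^ 2 ≠ 0 := by positivity
  have hn := (hasStrictFDerivAt_norm_sq x).hasFDerivAt
  have h := (((hn.const_sub 1).mul ((hasDerivAt_inv h2).comp_hasFDerivAt x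
    (hn.const_add 1))).smul (hasFDerivAt_id x))
  have hV : fderiv ℝ radialField x u = ((1 - ‖x‖ ^ 2) / (1 + ‖x‖ ^ 2)) • u -
      (4 * ⟪x, u⟫_ℝ / (1 + ‖x‖ ^ 2) ^ 2) • x := by
    have h' : HasFDerivAt radialField _ x := h
    rw [h'.fderiv]
    simp
    match_scalars <;> field_simp
    ring
  rw [hV, hypChristoffel, hypInner, radialField]
  simp only [real_inner_smul_left, real_inner_smul_right, real_inner_self_eq_norm_sq, smul_smul,
    smul_sub, smul_add, real_inner_comm x u]
  match_scalars <;> field_simp <;> ring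

/-- Metric compatibility of the connection with symbol `hypChristoffel`, for vector fields `V`, `W`
along a map `F` to hyperbolic space. -/
theorem fderiv_hypInner_comp {E : Type*} [NormedAddCommGroup E] [NormedSpace ℝ E]
    {F V W : E → EuclideanSpace ℝ (Fin d)} {F' V' W' : E →L[ℝ] EuclideanSpace ℝ (Fin d)} {x : E}
    (hF : HasFDerivAt F F' x) (hV : HasFDerivAt V V' x) (hW : HasFDerivAt W W' x)
    (hx : ‖F x‖ < 1) (u : E) :
    fderiv ℝ (fun z ↦ hypInner (F z) (V z) (W z)) x u =
      hypInner (F x) (V' u + hypChristoffel (F x) (F' u) (V x)) (W x) +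
        hypInner (F x) (V x) (W' u + hypChristoffel (F x) (F' u) (W x)) := by
  have h1 := (one_sub_norm_sq_pos hx).ne'
  have h := (((((hasDerivAt_inv h1).comp_hasFDerivAt x (hF.norm_sq.const_sub 1)).const_mul
    2).pow 2).mul (hV.inner ℝ hW))
  have h' : HasFDerivAt (fun z ↦ hypInner (F z) (V z) (W z)) _ x := h
  rw [h'.fderiv]
  simp only [hypInner, hypChristoffel]
  simp [real_inner_smul_left, real_inner_smul_right, inner_add_left, inner_add_right,
    inner_sub_left, inner_sub_right]
  rw [real_inner_comm (F x) (V x), real_inner_comm (F' u) (V x)]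
  field_simp
  ring

end PoincareMetric

/-! ### Derivatives of determinants -/

section Determinant

variable {E κ : Type*} [NormedAddCommGroup E] [NormedSpace ℝ E] [Fintype κ] [DecidableEq κ]
  {A : E → Matrix κ κ ℝ} {x : E}

theorem contDiffAt_matrix_det {n : WithTop ℕ∞} (h : ∀ i j, ContDiffAt ℝ n (fun z ↦ A z i j) x) :
    ContDiffAt ℝ n (fun z ↦ (A z).det) x := by
  simp only [Matrix.det_apply']
  exact ContDiffAt.sum fun σ _ ↦ contDiffAt_const.mul (contDiffAt_prod fun i _ ↦ h _ _)

theorem contDiffAt_matrix_adjugate {n : WithTop ℕ∞}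
    (h : ∀ i j, ContDiffAt ℝ n (fun z ↦ A z i j) x) (i j : κ) :
    ContDiffAt ℝ n (fun z ↦ (A z).adjugate i j) x := by
  simp only [Matrix.adjugate_apply]
  refine contDiffAt_matrix_det fun a b ↦ ?_
  simp only [Matrix.updateRow_apply]
  split_ifs
  · exact contDiffAt_const
  · exact h a b

/-- The differential of the determinant at the identity matrix is the trace. -/
theorem fderiv_matrix_det_of_eq_one (h : ∀ i j, DifferentiableAt ℝ (fun z ↦ A z i j) x)
    (hA : A x = 1) (u : E) :
    fderiv ℝ (fun z ↦ (A z).det) x u = ∑ i, fderiv ℝ (fun z ↦ A z i i) x u := by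
  simp only [Matrix.det_apply']
  have h1 : ∀ σ : Equiv.Perm κ, HasFDerivAt (fun z ↦ ((σ.sign : ℤ) : ℝ) * ∏ i, A z (σ i) i)
      (((σ.sign : ℤ) : ℝ) • ∑ i, (∏ j ∈ Finset.univ.erase i, A x (σ j) j) •
        fderiv ℝ (fun z ↦ A z (σ i) i) x) x := fun σ ↦
    (HasFDerivAt.finsetProd fun i _ ↦ (h (σ i) i).hasFDerivAt).const_mul _
  rw [(HasFDerivAt.fun_sum fun σ _ ↦ h1 σ).fderiv, Finset.sum_eq_single 1]
  · simp [hA]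
  · intro σ _ hσ
    have : ∀ i, ∏ j ∈ Finset.univ.erase i, A x (σ j) j = 0 := fun i ↦ by
      -- a permutation fixing all points but `i` also fixes `i`
      obtain ⟨j, hj, hne⟩ : ∃ j, j ≠ i ∧ σ j ≠ j := by
        by_contra! hc
        refine hσ (Equiv.ext fun j ↦ ?_)
        rcases eq_or_ne j i with rfl | hj
        · by_contra hne
          exact hne (σ.injective (hc _ hne))
        · exact hc j hj
      exact Finset.prod_eq_zero (Finset.mem_erase.2 ⟨hj, Finset.mem_univ j⟩)
        (by rw [hA, Matrix.one_apply_ne hne])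
    simp [this]
  · simp

end Determinant

/-! ### The divergence theorem in Euclidean space -/

section Divergence

variable {m : ℕ}

/-- The divergence of a compactly supported vector field has vanishing integral. -/
theorem integral_divergence_eq_zero {Φ : EuclideanSpace ℝ (Fin m) → EuclideanSpace ℝ (Fin m)}
    (hΦ : ContDiff ℝ 1 Φ) (hc : HasCompactSupport Φ) :
    ∫ x, ∑ i, fderiv ℝ Φ x (EuclideanSpace.single i 1) i = 0 := by
  have hcomp : ∀ i : Fin m, ContDiff ℝ 1 fun x ↦ Φ x i := fun i ↦
    (EuclideanSpace.proj (𝕜 := ℝ) i).contDiff.comp hΦ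
  have hsupp : ∀ i : Fin m, HasCompactSupport fun x ↦ Φ x i := fun i ↦
    hc.comp_left (g := fun y : EuclideanSpace ℝ (Fin m) ↦ y i) rfl
  have hfd : ∀ (i : Fin m) x v, fderiv ℝ Φ x v i = fderiv ℝ (fun x ↦ Φ x i) x v := fun i x v ↦ by
    have := ((EuclideanSpace.proj (𝕜 := ℝ) i).hasFDerivAt.comp x
      (hΦ.differentiable one_ne_zero x).hasFDerivAt).fderiv
    exact (congrArg (fun L : _ →L[ℝ] ℝ ↦ L v) this).symm
  simp only [hfd]
  have hint : ∀ i : Fin m, Integrable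
      fun x ↦ fderiv ℝ (fun x ↦ Φ x i) x (EuclideanSpace.single i 1) := fun i ↦ by
    refine Continuous.integrable_of_hasCompactSupport ?_ ?_
    · exact ((hcomp i).continuous_fderiv one_ne_zero).clm_apply continuous_const
    · exact (hsupp i).fderiv_apply (𝕜 := ℝ) _
  rw [integral_finsetSum _ fun i _ ↦ hint i]
  refine Finset.sum_eq_zero fun i _ ↦ ?_
  have := integral_mul_fderiv_eq_neg_fderiv_mul_of_integrable
    (μ := (volume : Measure (EuclideanSpace ℝ (Fin m))))
    (f := fun _ ↦ (1 : ℝ)) (g := fun x ↦ Φ x i) (v := EuclideanSpace.single i (1 : ℝ))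
    (by simp) (by simpa using hint i)
    (by simpa using (hcomp i).continuous.integrable_of_hasCompactSupport (hsupp i))
    (fun _ _ ↦ by fun_prop) (fun x _ ↦ (hcomp i).differentiable one_ne_zero x)
  simpa using this

end Divergence

/-! ### Immersions in coordinates -/

section ImmersionOn

variable {m d : ℕ}

/-- `F` is a smooth immersion of the open subset `U` of `ℝᵐ` into the unit ball of `ℝᵈ`. -/
structure IsHypImmersionOn (U : Set (EuclideanSpace ℝ (Fin m)))
    (F : EuclideanSpace ℝ (Fin m) → EuclideanSpace ℝ (Fin d)) : Prop where
  isOpen : IsOpen U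
  contDiffOn : ContDiffOn ℝ ∞ F U
  mem_ball : ∀ x ∈ U, ‖F x‖ < 1
  injective : ∀ x ∈ U, Function.Injective (fderiv ℝ F x)

/-- The Riemannian metric `g_x(v, w)` induced by `F` from the Poincaré metric. -/
noncomputable def inducedMetric (F : EuclideanSpace ℝ (Fin m) → EuclideanSpace ℝ (Fin d))
    (x v w : EuclideanSpace ℝ (Fin m)) : ℝ :=
  hypInner (F x) (fderiv ℝ F x v) (fderiv ℝ F x w)

/-- The matrix of the induced metric in the standard basis. -/
noncomputable def inducedGram (F : EuclideanSpace ℝ (Fin m) → EuclideanSpace ℝ (Fin d))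
    (x : EuclideanSpace ℝ (Fin m)) : Matrix (Fin m) (Fin m) ℝ :=
  Matrix.of fun i j ↦ inducedMetric F x (EuclideanSpace.single i 1) (EuclideanSpace.single j 1)

/-- The density `√(det gᵢⱼ)` of the volume of the induced metric. -/
noncomputable def volumeDensity (F : EuclideanSpace ℝ (Fin m) → EuclideanSpace ℝ (Fin d))
    (x : EuclideanSpace ℝ (Fin m)) : ℝ :=
  √(inducedGram F x).det

/-- The tangential part of `radialField` along `F`, in coordinates:
`Xⁱ = gⁱʲ ⟨radialField, ∂ⱼF⟩`. -/
noncomputable def tangentialField (F : EuclideanSpace ℝ (Fin m) → EuclideanSpace ℝ (Fin d))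
    (x : EuclideanSpace ℝ (Fin m)) : EuclideanSpace ℝ (Fin m) :=
  WithLp.toLp 2 ((inducedGram F x)⁻¹.mulVec fun j ↦
    hypInner (F x) (radialField (F x)) (fderiv ℝ F x (EuclideanSpace.single j 1)))

variable {U : Set (EuclideanSpace ℝ (Fin m))}
  {F : EuclideanSpace ℝ (Fin m) → EuclideanSpace ℝ (Fin d)} {x : EuclideanSpace ℝ (Fin m)}

theorem sum_smul_single (v : EuclideanSpace ℝ (Fin m)) :
    ∑ i, v i • EuclideanSpace.single i (1 : ℝ) = v := by
  ext j
  simp [Pi.single_apply]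

theorem inducedMetric_eq_dotProduct (v w : EuclideanSpace ℝ (Fin m)) :
    inducedMetric F x v w = dotProduct v.ofLp ((inducedGram F x).mulVec w.ofLp) := by
  have hv : fderiv ℝ F x v = ∑ i, v i • fderiv ℝ F x (EuclideanSpace.single i 1) := by
    conv_lhs => rw [← sum_smul_single v]
    simp
  have hw : fderiv ℝ F x w = ∑ i, w i • fderiv ℝ F x (EuclideanSpace.single i 1) := by
    conv_lhs => rw [← sum_smul_single w]
    simp
  rw [inducedMetric, hv, hw]
  simp only [hypInner, dotProduct, Matrix.mulVec, inducedGram, inducedMetric, Matrix.of_apply,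
    sum_inner, inner_sum, real_inner_smul_left, real_inner_smul_right, Finset.mul_sum]
  rw [Finset.sum_comm]
  exact Finset.sum_congr rfl fun i _ ↦ Finset.sum_congr rfl fun j _ ↦ by ring

namespace IsHypImmersionOn

theorem contDiffAt (hF : IsHypImmersionOn U F) (hx : x ∈ U) : ContDiffAt ℝ ∞ F x :=
  hF.contDiffOn.contDiffAt (hF.isOpen.mem_nhds hx)

theorem contDiffAt_fderiv (hF : IsHypImmersionOn U F) (hx : x ∈ U) :
    ContDiffAt ℝ ∞ (fderiv ℝ F) x :=
  (hF.contDiffAt hx).fderiv_right (by simp)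

theorem contDiffAt_fderiv_apply (hF : IsHypImmersionOn U F) (hx : x ∈ U)
    (v : EuclideanSpace ℝ (Fin m)) : ContDiffAt ℝ ∞ (fun z ↦ fderiv ℝ F z v) x :=
  (hF.contDiffAt_fderiv hx).clm_apply contDiffAt_const

theorem contDiffAt_hypInner (hF : IsHypImmersionOn U F) (hx : x ∈ U)
    {V W : EuclideanSpace ℝ (Fin m) → EuclideanSpace ℝ (Fin d)}
    (hV : ContDiffAt ℝ ∞ V x) (hW : ContDiffAt ℝ ∞ W x) :
    ContDiffAt ℝ ∞ (fun z ↦ hypInner (F z) (V z) (W z)) x :=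
  ((contDiffAt_const.div (contDiffAt_const.sub ((hF.contDiffAt hx).norm_sq ℝ))
    (one_sub_norm_sq_pos (hF.mem_ball x hx)).ne').pow 2).mul (hV.inner ℝ hW)

theorem contDiffAt_inducedMetric (hF : IsHypImmersionOn U F) (hx : x ∈ U)
    (v w : EuclideanSpace ℝ (Fin m)) : ContDiffAt ℝ ∞ (fun z ↦ inducedMetric F z v w) x :=
  hF.contDiffAt_hypInner hx (hF.contDiffAt_fderiv_apply hx v) (hF.contDiffAt_fderiv_apply hx w)

theorem contDiffAt_radialField (hF : IsHypImmersionOn U F) (hx : x ∈ U) :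
    ContDiffAt ℝ ∞ (fun z ↦ radialField (F z)) x :=
  contDiff_radialField.contDiffAt.comp x (hF.contDiffAt hx)

theorem posDef_inducedGram (hF : IsHypImmersionOn U F) (hx : x ∈ U) :
    (inducedGram F x).PosDef := by
  refine Matrix.PosDef.of_dotProduct_mulVec_pos ?_ fun v hv ↦ ?_
  · ext i j
    simp [inducedGram, inducedMetric, hypInner_comm]
  · have := inducedMetric_eq_dotProduct (F := F) (x := x) (WithLp.toLp 2 v) (WithLp.toLp 2 v)
    simp only [star_trivial]
    rw [← this]
    refine hypInner_self_pos (hF.mem_ball x hx) fun h0 ↦ hv ?_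
    have := hF.injective x hx (h0.trans (map_zero _).symm)
    simpa using this

theorem volumeDensity_pos (hF : IsHypImmersionOn U F) (hx : x ∈ U) : 0 < volumeDensity F x :=
  Real.sqrt_pos.2 (hF.posDef_inducedGram hx).det_pos

theorem contDiffAt_volumeDensity (hF : IsHypImmersionOn U F) (hx : x ∈ U) :
    ContDiffAt ℝ ∞ (volumeDensity F) x :=
  (contDiffAt_matrix_det fun _ _ ↦ hF.contDiffAt_inducedMetric hx _ _).sqrt
    (hF.posDef_inducedGram hx).det_pos.ne'

theorem contDiffAt_tangentialField (hF : IsHypImmersionOn U F) (hx : x ∈ U) :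
    ContDiffAt ℝ ∞ (tangentialField F) x := by
  refine contDiffAt_piLp' 2 fun i ↦ ?_
  simp only [tangentialField, Matrix.mulVec, dotProduct, Matrix.inv_def, Ring.inverse_eq_inv',
    Matrix.smul_apply, smul_eq_mul]
  have hG : ∀ i j, ContDiffAt ℝ ∞ (fun z ↦ inducedGram F z i j) x := fun i j ↦
    hF.contDiffAt_inducedMetric hx _ _
  refine ContDiffAt.sum fun j _ ↦ (ContDiffAt.mul ?_ (contDiffAt_matrix_adjugate hG i j)).mul ?_
  · exact (contDiffAt_matrix_det hG).inv (hF.posDef_inducedGram hx).det_pos.ne'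
  · exact hF.contDiffAt_hypInner hx (hF.contDiffAt_radialField hx) (hF.contDiffAt_fderiv_apply hx _)

/-- The tangential field represents the covector `⟨radialField, dF ·⟩` for the induced metric. -/
theorem inducedMetric_tangentialField (hF : IsHypImmersionOn U F) (hx : x ∈ U)
    (v : EuclideanSpace ℝ (Fin m)) :
    inducedMetric F x v (tangentialField F x) =
      hypInner (F x) (radialField (F x)) (fderiv ℝ F x v) := by
  rw [inducedMetric_eq_dotProduct, tangentialField, Matrix.mulVec_mulVec, Matrix.mul_nonsing_inv _
    (hF.posDef_inducedGram hx).det_pos.ne'.isUnit, Matrix.one_mulVec]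
  conv_rhs => rw [← sum_smul_single v]
  simp [dotProduct, hypInner_comm _ (radialField _), hypInner_sum_left, hypInner_smul_left]

end IsHypImmersionOn

end ImmersionOn

/-! ### The divergence of the tangential field -/

section DivergenceBound

variable {m d : ℕ} {U : Set (EuclideanSpace ℝ (Fin m))}
  {F : EuclideanSpace ℝ (Fin m) → EuclideanSpace ℝ (Fin d)} {x : EuclideanSpace ℝ (Fin m)}

/-- The covariant derivative `∇_v (dF(w)) = D²F(v, w) + Γ(dF v, dF w)` along `F`, for constant
coordinate vector fields `v`, `w`. -/
noncomputable def covariantHessian (F : EuclideanSpace ℝ (Fin m) → EuclideanSpace ℝ (Fin d))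
    (x v w : EuclideanSpace ℝ (Fin m)) : EuclideanSpace ℝ (Fin d) :=
  fderiv ℝ (fderiv ℝ F) x v w + hypChristoffel (F x) (fderiv ℝ F x v) (fderiv ℝ F x w)

/-- The vectors `βₐ` form an orthonormal basis of `ℝᵐ` for the metric induced by `F` at `x`. -/
def IsInducedFrame (F : EuclideanSpace ℝ (Fin m) → EuclideanSpace ℝ (Fin d))
    (x : EuclideanSpace ℝ (Fin m)) (β : Fin m → EuclideanSpace ℝ (Fin m)) : Prop :=
  ∀ a b, inducedMetric F x (β a) (β b) = (1 : Matrix (Fin m) (Fin m) ℝ) a b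

namespace IsInducedFrame

variable {β : Fin m → EuclideanSpace ℝ (Fin m)}

theorem matrix_mul_eq_one (hβ : IsInducedFrame F x β) :
    (Matrix.of fun a i ↦ β a i) * inducedGram F x * (Matrix.of fun a i ↦ β a i).transpose = 1 := by
  ext a b
  rw [← hβ a b, inducedMetric_eq_dotProduct, Matrix.mul_assoc]
  simp [Matrix.mul_apply, dotProduct, Matrix.mulVec]

theorem transpose_mul_eq_one (hβ : IsInducedFrame F x β) :
    (Matrix.of fun a i ↦ β a i).transpose * ((Matrix.of fun a i ↦ β a i) * inducedGram F x) = 1 :=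
  mul_eq_one_comm.1 hβ.matrix_mul_eq_one

theorem sum_inducedMetric_smul (hβ : IsInducedFrame F x β) (v : EuclideanSpace ℝ (Fin m)) :
    ∑ a, inducedMetric F x (β a) v • β a = v := by
  have h := congrArg (fun A ↦ Matrix.mulVec A v.ofLp) hβ.transpose_mul_eq_one
  simp only [← Matrix.mulVec_mulVec, Matrix.one_mulVec] at h
  ext i
  conv_rhs => rw [← h]
  simp [inducedMetric_eq_dotProduct, Matrix.mulVec, dotProduct, mul_comm]

theorem sum_inducedMetric_sq (hβ : IsInducedFrame F x β) (v : EuclideanSpace ℝ (Fin m)) :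
    ∑ a, inducedMetric F x (β a) v ^ 2 = inducedMetric F x v v := by
  conv_rhs => rw [inducedMetric]; enter [2]; rw [← hβ.sum_inducedMetric_smul v]
  simp only [map_sum, map_smul, hypInner_sum_left, hypInner_smul_left]
  exact Finset.sum_congr rfl fun a _ ↦ by rw [sq, inducedMetric]

/-- The trace of an endomorphism can be computed in an orthonormal frame. -/
theorem trace_eq (hβ : IsInducedFrame F x β)
    (L : EuclideanSpace ℝ (Fin m) →L[ℝ] EuclideanSpace ℝ (Fin m)) :
    ∑ i, L (EuclideanSpace.single i 1) i = ∑ a, inducedMetric F x (β a) (L (β a)) := by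
  have h : ∀ i, L (EuclideanSpace.single i 1) i =
      ∑ a, inducedMetric F x (β a) (L (EuclideanSpace.single i 1)) * β a i := fun i ↦ by
    conv_lhs => rw [← hβ.sum_inducedMetric_smul (L (EuclideanSpace.single i 1))]
    simp
  simp only [h]
  rw [Finset.sum_comm]
  refine Finset.sum_congr rfl fun a _ ↦ ?_
  have hL : L (β a) = ∑ i, β a i • L (EuclideanSpace.single i 1) := by
    conv_lhs => rw [← sum_smul_single (β a)]
    simp
  simp only [hL, inducedMetric, map_sum, map_smul]
  simp only [hypInner_comm (F x) (fderiv ℝ F x (β a)), hypInner_sum_left, hypInner_smul_left,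
    mul_comm]

end IsInducedFrame

namespace IsHypImmersionOn

theorem covariantHessian_symm (hF : IsHypImmersionOn U F) (hx : x ∈ U)
    (v w : EuclideanSpace ℝ (Fin m)) : covariantHessian F x v w = covariantHessian F x w v := by
  rw [covariantHessian, covariantHessian, hypChristoffel_symm]
  congr 1
  exact (hF.contDiffAt hx).isSymmSndFDerivAt (by
    rw [minSmoothness_of_isRCLikeNormedField]
    exact WithTop.coe_le_coe.2 le_top) v w

theorem hasFDerivAt (hF : IsHypImmersionOn U F) (hx : x ∈ U) :
    HasFDerivAt F (fderiv ℝ F x) x :=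
  ((hF.contDiffAt hx).differentiableAt (by simp)).hasFDerivAt

theorem hasFDerivAt_fderiv (hF : IsHypImmersionOn U F) (hx : x ∈ U) :
    HasFDerivAt (fderiv ℝ F) (fderiv ℝ (fderiv ℝ F) x) x :=
  ((hF.contDiffAt_fderiv hx).differentiableAt (by simp)).hasFDerivAt

theorem hasFDerivAt_tangentialField (hF : IsHypImmersionOn U F) (hx : x ∈ U) :
    HasFDerivAt (tangentialField F) (fderiv ℝ (tangentialField F) x) x :=
  ((hF.contDiffAt_tangentialField hx).differentiableAt (by simp)).hasFDerivAt

theorem fderiv_inducedMetric (hF : IsHypImmersionOn U F) (hx : x ∈ U)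
    (u v w : EuclideanSpace ℝ (Fin m)) :
    fderiv ℝ (fun z ↦ inducedMetric F z v w) x u =
      hypInner (F x) (covariantHessian F x u v) (fderiv ℝ F x w) +
        hypInner (F x) (fderiv ℝ F x v) (covariantHessian F x u w) := by
  have h := hF.hasFDerivAt_fderiv hx
  refine (fderiv_hypInner_comp (hF.hasFDerivAt hx) (h.clm_apply (hasFDerivAt_const v x))
    (h.clm_apply (hasFDerivAt_const w x)) (hF.mem_ball x hx) u).trans ?_
  simp [covariantHessian]

/-- The logarithmic differential of the volume density is half the trace of the differential of
the metric. -/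
theorem fderiv_volumeDensity (hF : IsHypImmersionOn U F) (hx : x ∈ U)
    {β : Fin m → EuclideanSpace ℝ (Fin m)} (hβ : IsInducedFrame F x β)
    (u : EuclideanSpace ℝ (Fin m)) :
    fderiv ℝ (volumeDensity F) x u = volumeDensity F x *
      ∑ a, hypInner (F x) (covariantHessian F x u (β a)) (fderiv ℝ F x (β a)) := by
  have hG : DifferentiableAt ℝ (fun z ↦ (inducedGram F z).det) x :=
    (contDiffAt_matrix_det (n := ∞) fun _ _ ↦ hF.contDiffAt_inducedMetric hx _ _).differentiableAt
      (by simp)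
  have hpos := (hF.posDef_inducedGram hx).det_pos
  -- the Gram matrix of the constant frame `β` is the identity at `x`, where its determinant has
  -- the trace as differential; it differs from the coordinate one by a constant factor
  set c := (Matrix.of fun a i ↦ β a i).det with hc
  have hdet : ∀ z, (Matrix.of fun a b ↦ inducedMetric F z (β a) (β b)).det =
      c ^ 2 * (inducedGram F z).det := fun z ↦ by
    have : (Matrix.of fun a b ↦ inducedMetric F z (β a) (β b)) =
        (Matrix.of fun a i ↦ β a i) * inducedGram F z *
          (Matrix.of fun a i ↦ β a i).transpose := by
      ext a b
      rw [Matrix.of_apply, inducedMetric_eq_dotProduct, Matrix.mul_assoc]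
      simp [Matrix.mul_apply, dotProduct, Matrix.mulVec]
    rw [this, Matrix.det_mul, Matrix.det_mul, Matrix.det_transpose]
    ring
  have hone : (Matrix.of fun a b ↦ inducedMetric F x (β a) (β b)) = 1 := by
    ext a b
    exact hβ a b
  have hcx : c ^ 2 * (inducedGram F x).det = 1 := by rw [← hdet, hone, Matrix.det_one]
  have h1 := fderiv_matrix_det_of_eq_one
    (A := fun z ↦ Matrix.of fun a b ↦ inducedMetric F z (β a) (β b))
    (fun a b ↦ (hF.contDiffAt_inducedMetric hx (β a) (β b)).differentiableAt (by simp)) hone u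
  simp only [hdet, Matrix.of_apply, hF.fderiv_inducedMetric hx] at h1
  rw [fderiv_const_mul hG] at h1
  have h2 : fderiv ℝ (fun z ↦ (inducedGram F z).det) x u = 2 * (inducedGram F x).det *
      ∑ a, hypInner (F x) (covariantHessian F x u (β a)) (fderiv ℝ F x (β a)) := by
    simp only [hypInner_comm (F x) (fderiv ℝ F x _), ← two_mul, ← Finset.mul_sum] at h1
    simp only [smul_apply, smul_eq_mul] at h1
    linear_combination (inducedGram F x).det * h1 -
      fderiv ℝ (fun z ↦ (inducedGram F z).det) x u * hcx
  have h3 : fderiv ℝ (volumeDensity F) x = (1 / (2 * √(inducedGram F x).det)) •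
      fderiv ℝ (fun z ↦ (inducedGram F z).det) x := fderiv_sqrt hG hpos.ne'
  rw [h3, smul_apply, h2, volumeDensity, smul_eq_mul]
  have h4 := Real.sqrt_pos.2 hpos
  have h5 := Real.mul_self_sqrt hpos.le
  generalize ∑ a, hypInner (F x) (covariantHessian F x u (β a)) (fderiv ℝ F x (β a)) = s
  nth_rewrite 2 [← h5]
  field_simp

/-- The covariant derivative of the tangential field: tangential part of `∇V = id - V ⊗ V`,
corrected by the second fundamental form. -/
theorem inducedMetric_fderiv_tangentialField (hF : IsHypImmersionOn U F) (hx : x ∈ U)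
    (u v : EuclideanSpace ℝ (Fin m)) :
    inducedMetric F x v (fderiv ℝ (tangentialField F) x u) =
      inducedMetric F x u v - inducedMetric F x u (tangentialField F x) *
          inducedMetric F x v (tangentialField F x) +
        hypInner (F x) (radialField (F x) - fderiv ℝ F x (tangentialField F x))
          (covariantHessian F x u v) -
        hypInner (F x) (fderiv ℝ F x v) (covariantHessian F x u (tangentialField F x)) := by
  have hD := hF.hasFDerivAt_fderiv hx
  have h1 : fderiv ℝ (fun z ↦ inducedMetric F z v (tangentialField F z)) x u =
      hypInner (F x) (covariantHessian F x u v) (fderiv ℝ F x (tangentialField F x)) +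
        hypInner (F x) (fderiv ℝ F x v) (covariantHessian F x u (tangentialField F x)) +
        inducedMetric F x v (fderiv ℝ (tangentialField F) x u) := by
    refine (fderiv_hypInner_comp (hF.hasFDerivAt hx) (hD.clm_apply (hasFDerivAt_const v x))
      (hD.clm_apply (hF.hasFDerivAt_tangentialField hx)) (hF.mem_ball x hx) u).trans ?_
    rw [inducedMetric, add_assoc]
    congr 1
    · simp [covariantHessian]
    · simp only [hypInner_comm (F x) (fderiv ℝ F x v)]
      rw [← hypInner_add_left]
      congr 1
      simp [covariantHessian]
      abel
  have h2 : fderiv ℝ (fun z ↦ hypInner (F z) (radialField (F z)) (fderiv ℝ F z v)) x u =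
      inducedMetric F x u v - hypInner (F x) (radialField (F x)) (fderiv ℝ F x u) *
          hypInner (F x) (radialField (F x)) (fderiv ℝ F x v) +
        hypInner (F x) (radialField (F x)) (covariantHessian F x u v) := by
    have hV : HasFDerivAt radialField (fderiv ℝ radialField (F x)) (F x) :=
      (contDiff_radialField.differentiable one_ne_zero _).hasFDerivAt
    refine (fderiv_hypInner_comp (hF.hasFDerivAt hx) (hV.comp x (hF.hasFDerivAt hx))
      (hD.clm_apply (hasFDerivAt_const v x)) (hF.mem_ball x hx) u).trans ?_
    rw [ContinuousLinearMap.comp_apply, Function.comp_apply,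
      fderiv_radialField_add_hypChristoffel (hF.mem_ball x hx), hypInner_sub_left,
      hypInner_smul_left, inducedMetric]
    simp [covariantHessian]
  have h3 : (fun z ↦ inducedMetric F z v (tangentialField F z)) =ᶠ[𝓝 x]
      fun z ↦ hypInner (F z) (radialField (F z)) (fderiv ℝ F z v) :=
    Filter.mem_of_superset (hF.isOpen.mem_nhds hx)
      fun z hz ↦ hF.inducedMetric_tangentialField hz v
  rw [h3.fderiv_eq, h2] at h1
  rw [hF.inducedMetric_tangentialField hx u, hF.inducedMetric_tangentialField hx v,
    hypInner_sub_left, hypInner_comm _ (fderiv ℝ F x (tangentialField F x))]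
  linarith

/-- Pythagoras: the radial field is the orthogonal sum of its tangential and normal parts. -/
theorem inducedMetric_tangentialField_self_add (hF : IsHypImmersionOn U F) (hx : x ∈ U) :
    inducedMetric F x (tangentialField F x) (tangentialField F x) +
      hypInner (F x) (radialField (F x) - fderiv ℝ F x (tangentialField F x))
        (radialField (F x) - fderiv ℝ F x (tangentialField F x)) =
      hypInner (F x) (radialField (F x)) (radialField (F x)) := by
  have h := hF.inducedMetric_tangentialField hx (tangentialField F x)
  rw [hypInner_sub_left, hypInner_comm _ (radialField (F x)), hypInner_comm _ (fderiv ℝ F x _),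
    hypInner_sub_left, hypInner_sub_left, hypInner_comm _ (fderiv ℝ F x _) (radialField _), ← h,
    inducedMetric]
  ring

/-- The divergence `div X = m - |X|² + ⟨V^⊥, H⟩` of the tangential part `X` of the radial field `V`
is at least `m - 1 - |H|`. The left side is the coordinate expression `√(det g) div X`. -/
theorem le_divergence_tangentialField (hF : IsHypImmersionOn U F) (hx : x ∈ U)
    {β : Fin m → EuclideanSpace ℝ (Fin m)} (hβ : IsInducedFrame F x β) {α : ℝ}
    (hα : hypNorm (F x) ((fderiv ℝ F x).toLinearMap.rangeᗮ.starProjection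
      (∑ a, covariantHessian F x (β a) (β a))) ≤ α) :
    (m - 1 - α) * volumeDensity F x ≤
      volumeDensity F x * ∑ i, fderiv ℝ (tangentialField F) x (EuclideanSpace.single i 1) i +
        fderiv ℝ (volumeDensity F) x (tangentialField F x) := by
  set X := tangentialField F x with hX
  set N := radialField (F x) - fderiv ℝ F x X with hN
  set S := ∑ a, covariantHessian F x (β a) (β a) with hS
  have hdiv : ∑ i, fderiv ℝ (tangentialField F) x (EuclideanSpace.single i 1) i +
      ∑ a, hypInner (F x) (covariantHessian F x X (β a)) (fderiv ℝ F x (β a)) =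
      m - inducedMetric F x X X + hypInner (F x) N S := by
    rw [hβ.trace_eq, ← Finset.sum_add_distrib, ← hβ.sum_inducedMetric_sq X, hypInner_comm _ N,
      hypInner_sum_left]
    have hm : (m : ℝ) = ∑ a : Fin m, inducedMetric F x (β a) (β a) := by simp [hβ _ _]
    rw [hm, ← Finset.sum_sub_distrib, ← Finset.sum_add_distrib]
    refine Finset.sum_congr rfl fun a _ ↦ ?_
    rw [hF.inducedMetric_fderiv_tangentialField hx, hF.covariantHessian_symm hx X,
      hypInner_comm _ (fderiv ℝ F x (β a)), hypInner_comm _ N]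
    ring
  have hNS : hypInner (F x) N S =
      hypInner (F x) N ((fderiv ℝ F x).toLinearMap.rangeᗮ.starProjection S) := by
    have hmem : N ∈ (fderiv ℝ F x).toLinearMap.rangeᗮ := by
      rintro _ ⟨v, rfl⟩
      have h1 : hypInner (F x) (fderiv ℝ F x v) N = 0 := by
        rw [hypInner_comm, hN, hypInner_sub_left, ← hF.inducedMetric_tangentialField hx v,
          hypInner_comm, inducedMetric, sub_self]
      exact (mul_eq_zero.1 h1).resolve_left
        (pow_pos (div_pos two_pos (one_sub_norm_sq_pos (hF.mem_ball x hx))) 2).ne'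
    rw [hypInner, hypInner, ← Submodule.inner_starProjection_left_eq_right,
      Submodule.starProjection_eq_self_iff.2 hmem]
  have hsum := hF.inducedMetric_tangentialField_self_add hx
  rw [← hX, ← hN] at hsum
  have hle := hypInner_radialField_self_le_one (hF.mem_ball x hx)
  have hXX : 0 ≤ inducedMetric F x X X := hypInner_self_nonneg _ _
  have hN1 : hypNorm (F x) N ≤ 1 := Real.sqrt_le_one.2 (by linarith)
  have habs : |hypInner (F x) N S| ≤ α := by
    rw [hNS]
    refine (abs_hypInner_le _ _ _).trans ?_
    exact (mul_le_of_le_one_left (Real.sqrt_nonneg _) hN1).trans hα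
  have hNN := hypInner_self_nonneg (F x) N
  rw [hF.fderiv_volumeDensity hx hβ, ← mul_add, hdiv, mul_comm]
  refine mul_le_mul_of_nonneg_left ?_ (hF.volumeDensity_pos hx).le
  linarith [(abs_le.1 habs).1]

end IsHypImmersionOn

end DivergenceBound

/-! ### Integration by parts in a chart -/

section IntegralInequality

variable {m d : ℕ} {U : Set (EuclideanSpace ℝ (Fin m))}
  {F : EuclideanSpace ℝ (Fin m) → EuclideanSpace ℝ (Fin d)}

theorem continuous_of_continuousOn_of_tsupport_subset {X Z : Type*} [TopologicalSpace X]
    [TopologicalSpace Z] [Zero Z] {q : X → Z} {U : Set X} (hU : IsOpen U) (hq : ContinuousOn q U)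
    (hs : tsupport q ⊆ U) : Continuous q := by
  rw [continuous_iff_continuousAt]
  intro x
  by_cases hx : x ∈ U
  · exact hq.continuousAt (hU.mem_nhds hx)
  · have : q =ᶠ[𝓝 x] fun _ ↦ 0 := notMem_tsupport_iff_eventuallyEq.1 fun h ↦ hx (hs h)
    exact continuousAt_const.congr this.symm

namespace IsHypImmersionOn

/-- Integration by parts against the tangential field: the divergence bound in integrated form, for
a nonnegative function supported in a chart. -/
theorem integral_fderiv_tangentialField_le (hF : IsHypImmersionOn U F) {α : ℝ}
    (hα : ∀ x ∈ U, ∃ β : Fin m → EuclideanSpace ℝ (Fin m), IsInducedFrame F x β ∧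
      hypNorm (F x) ((fderiv ℝ F x).toLinearMap.rangeᗮ.starProjection
        (∑ a, covariantHessian F x (β a) (β a))) ≤ α)
    {ψ : EuclideanSpace ℝ (Fin m) → ℝ} (hψ : ContDiff ℝ 1 ψ) (hc : HasCompactSupport ψ)
    (hs : tsupport ψ ⊆ U) (h0 : ∀ x, 0 ≤ ψ x) :
    (∫ x, fderiv ℝ ψ x (tangentialField F x) * volumeDensity F x) +
      (m - 1 - α) * ∫ x, ψ x * volumeDensity F x ≤ 0 := by
  set Φ : EuclideanSpace ℝ (Fin m) → EuclideanSpace ℝ (Fin m) :=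
    fun x ↦ (ψ x * volumeDensity F x) • tangentialField F x with hΦ
  have hJ : ∀ x ∈ U, HasFDerivAt (volumeDensity F) (fderiv ℝ (volumeDensity F) x) x := fun x hx ↦
    ((hF.contDiffAt_volumeDensity hx).differentiableAt (by simp)).hasFDerivAt
  have hΦs : tsupport Φ ⊆ tsupport ψ := by
    refine closure_mono fun x hx ↦ ?_
    rw [Function.mem_support] at hx ⊢
    contrapose! hx
    simp [hΦ, hx]
  have hΦd : ContDiff ℝ 1 Φ := by
    rw [contDiff_iff_contDiffAt]
    intro x
    by_cases hx : x ∈ U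
    · have h1 : (1 : WithTop ℕ∞) ≤ (∞ : WithTop ℕ∞) := WithTop.coe_le_coe.2 le_top
      exact (hψ.contDiffAt.mul ((hF.contDiffAt_volumeDensity hx).of_le h1)).smul
        ((hF.contDiffAt_tangentialField hx).of_le h1)
    · have : Φ =ᶠ[𝓝 x] fun _ ↦ 0 :=
        notMem_tsupport_iff_eventuallyEq.1 fun h ↦ hx (hs (hΦs h))
      exact contDiffAt_const.congr_of_eventuallyEq this
  have hΦc : HasCompactSupport Φ := hc.of_isClosed_subset (isClosed_tsupport _) hΦs
  have hcJ : ContinuousOn (volumeDensity F) U := fun x hx ↦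
    (hF.contDiffAt_volumeDensity hx).continuousAt.continuousWithinAt
  have hcX : ContinuousOn (tangentialField F) U := fun x hx ↦
    (hF.contDiffAt_tangentialField hx).continuousAt.continuousWithinAt
  have hint : ∀ q : EuclideanSpace ℝ (Fin m) → ℝ, ContinuousOn q U → tsupport q ⊆ tsupport ψ →
      Integrable q := fun q hq hqs ↦
    (continuous_of_continuousOn_of_tsupport_subset hF.isOpen hq
      (hqs.trans hs)).integrable_of_hasCompactSupport
        (hc.of_isClosed_subset (isClosed_tsupport _) hqs)
  have hi1 : Integrable fun x ↦ fderiv ℝ ψ x (tangentialField F x) * volumeDensity F x := by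
    refine hint _ (((hψ.continuous_fderiv one_ne_zero).continuousOn.clm_apply hcX).mul hcJ) ?_
    refine (closure_mono fun x hx ↦ ?_).trans (tsupport_fderiv_subset ℝ)
    rw [Function.mem_support] at hx ⊢
    contrapose! hx
    simp [hx]
  have hi2 : Integrable fun x ↦ ψ x * volumeDensity F x := by
    refine hint _ (hψ.continuous.continuousOn.mul hcJ) (closure_mono fun x hx ↦ ?_)
    rw [Function.mem_support] at hx ⊢
    exact left_ne_zero_of_mul hx
  rw [← integral_const_mul, ← integral_add hi1 (hi2.const_mul _),
    ← integral_divergence_eq_zero hΦd hΦc]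
  refine integral_mono (hi1.add (hi2.const_mul _)) ?_ fun x ↦ ?_
  · refine integrable_finsetSum _ fun i _ ↦ ?_
    refine Continuous.integrable_of_hasCompactSupport ?_ ?_
    · exact (EuclideanSpace.proj (𝕜 := ℝ) i).continuous.comp
        ((hΦd.continuous_fderiv one_ne_zero).clm_apply continuous_const)
    · exact (hΦc.fderiv_apply (𝕜 := ℝ) (EuclideanSpace.single i (1 : ℝ))).comp_left
        (g := fun y : EuclideanSpace ℝ (Fin m) ↦ y i) rfl
  · by_cases hx : x ∈ U
    · obtain ⟨β, hβ, hb⟩ := hα x hx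
      have hdiv := mul_le_mul_of_nonneg_left (hF.le_divergence_tangentialField hx hβ hb) (h0 x)
      have hfd := ((((hψ.differentiable one_ne_zero x).hasFDerivAt.mul (hJ x hx)).smul
        (hF.hasFDerivAt_tangentialField hx))).fderiv
      have hfd' : fderiv ℝ Φ x = _ := hfd
      have hX : ∀ L : EuclideanSpace ℝ (Fin m) →L[ℝ] ℝ, L (tangentialField F x) =
          ∑ i, L (EuclideanSpace.single i 1) * tangentialField F x i := fun L ↦ by
        conv_lhs => rw [← sum_smul_single (tangentialField F x)]
        simp [mul_comm]
      have : ∑ i, fderiv ℝ Φ x (EuclideanSpace.single i 1) i =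
          ψ x * (volumeDensity F x *
            ∑ i, fderiv ℝ (tangentialField F) x (EuclideanSpace.single i 1) i +
            fderiv ℝ (volumeDensity F) x (tangentialField F x)) +
          fderiv ℝ ψ x (tangentialField F x) * volumeDensity F x := by
        rw [hfd', hX, hX, Finset.mul_sum, Finset.sum_mul, ← Finset.sum_add_distrib,
          Finset.mul_sum, ← Finset.sum_add_distrib]
        refine Finset.sum_congr rfl fun i _ ↦ ?_
        simp
        ring
      beta_reduce
      rw [this]
      linarith
    · have h1 : ψ x = 0 := image_eq_zero_of_notMem_tsupport fun h ↦ hx (hs h)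
      have h2 : fderiv ℝ ψ x = 0 := image_eq_zero_of_notMem_tsupport fun h ↦
        hx (hs (tsupport_fderiv_subset ℝ h))
      have h3 : fderiv ℝ Φ x = 0 := image_eq_zero_of_notMem_tsupport fun h ↦
        hx (hs (hΦs (tsupport_fderiv_subset ℝ h)))
      simp [h1, h2, h3]

end IsHypImmersionOn

end IntegralInequality

/-! ### Charts and immersions -/

section Charts

variable {m d : ℕ} {Y : Type*} [EMetricSpace Y] [ChartedSpace (EuclideanSpace ℝ (Fin m)) Y]
  {e : OpenPartialHomeomorph Y (EuclideanSpace ℝ (Fin m))} {x : EuclideanSpace ℝ (Fin m)}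

/-- On the overlap of two charts, the coordinate expressions of a map differ by the coordinate
change. -/
theorem comp_symm_eventuallyEq {X E Z : Type*} [TopologicalSpace X] [TopologicalSpace E]
    (f : X → Z) {e e' : OpenPartialHomeomorph X E} {x : E}
    (hx : x ∈ e.target) (hx' : e.symm x ∈ e'.source) :
    f ∘ e.symm =ᶠ[𝓝 x] (f ∘ e'.symm) ∘ (e' ∘ e.symm) := by
  filter_upwards [(e.continuousAt_symm hx).preimage_mem_nhds (e'.open_source.mem_nhds hx')]
    with z hz
  simp [e'.left_inv hz]

/-- The differential of a smooth map at `y` is its differential in the preferred chart at `y`. -/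
theorem mfderiv_eq_fderiv_chartAt {p : ℕ} {f : Y → EuclideanSpace ℝ (Fin p)} {y : Y}
    (hf : MDifferentiableAt (𝓡 m) (𝓡 p) f y) :
    mfderiv (𝓡 m) (𝓡 p) f y = fderiv ℝ (f ∘ (chartAt (EuclideanSpace ℝ (Fin m)) y).symm)
      (chartAt (EuclideanSpace ℝ (Fin m)) y y) := by
  refine (if_pos hf).trans ?_
  simp only [writtenInExtChartAt, mfld_simps, fderivWithin_univ]
  rfl

theorem differential_eq_fderiv_chartAt {f : Y → ℝ} {y : Y}
    (hf : MDifferentiableAt (𝓡 m) 𝓘(ℝ, ℝ) f y) :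
    differential m f y = fderiv ℝ (f ∘ (chartAt (EuclideanSpace ℝ (Fin m)) y).symm)
      (chartAt (EuclideanSpace ℝ (Fin m)) y y) := by
  refine (if_pos hf).trans ?_
  simp only [writtenInExtChartAt, mfld_simps, fderivWithin_univ]
  rfl

variable [IsManifold (𝓡 m) ∞ Y]

theorem contMDiffOn_atlas_symm (he : e ∈ atlas (EuclideanSpace ℝ (Fin m)) Y) :
    ContMDiffOn (𝓡 m) (𝓡 m) ∞ e.symm e.target :=
  contMDiffOn_symm_of_mem_maximalAtlas (IsManifold.subset_maximalAtlas he)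

theorem mdifferentiableAt_symm_of_mem_atlas (he : e ∈ atlas (EuclideanSpace ℝ (Fin m)) Y)
    (hx : x ∈ e.target) : MDifferentiableAt (𝓡 m) (𝓡 m) e.symm x :=
  ((contMDiffOn_atlas_symm he).contMDiffAt (e.open_target.mem_nhds hx)).mdifferentiableAt (by simp)

/-- The differential of a chart inverse at `x` is that of the coordinate change to the preferred
chart at the image of `x`. -/
theorem mfderiv_symm_eq_fderiv (he : e ∈ atlas (EuclideanSpace ℝ (Fin m)) Y) (hx : x ∈ e.target) :
    mfderiv (𝓡 m) (𝓡 m) e.symm x =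
      fderiv ℝ (chartAt (EuclideanSpace ℝ (Fin m)) (e.symm x) ∘ e.symm) x := by
  refine (if_pos (mdifferentiableAt_symm_of_mem_atlas he hx)).trans ?_
  simp only [writtenInExtChartAt, mfld_simps, fderivWithin_univ]
  rfl

theorem injective_mfderiv_symm (he : e ∈ atlas (EuclideanSpace ℝ (Fin m)) Y) (hx : x ∈ e.target) :
    Function.Injective (mfderiv (𝓡 m) (𝓡 m) e.symm x) := by
  have : IsManifold (𝓡 m) 1 Y := IsManifold.of_le (n := ∞) (by simp)
  have h := (mdifferentiable_of_mem_atlas (I := 𝓡 m) he).comp_symm_deriv hx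
  intro v w hvw
  exact (congrArg (fun L : _ →L[ℝ] _ ↦ L v) h).symm.trans
    ((congrArg (mfderiv (𝓡 m) (𝓡 m) e (e.symm x)) hvw).trans (congrArg (fun L : _ →L[ℝ] _ ↦ L w) h))

theorem surjective_mfderiv_symm (he : e ∈ atlas (EuclideanSpace ℝ (Fin m)) Y) (hx : x ∈ e.target) :
    Function.Surjective (mfderiv (𝓡 m) (𝓡 m) e.symm x) := by
  let L : EuclideanSpace ℝ (Fin m) →L[ℝ] EuclideanSpace ℝ (Fin m) :=
    mfderiv (𝓡 m) (𝓡 m) e.symm x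
  exact LinearMap.injective_iff_surjective (f := L.toLinearMap) |>.1 (injective_mfderiv_symm he hx)

theorem contDiffOn_comp_symm {f : Y → ℝ} (hf : ContMDiff (𝓡 m) 𝓘(ℝ, ℝ) ∞ f)
    (he : e ∈ atlas (EuclideanSpace ℝ (Fin m)) Y) : ContDiffOn ℝ ∞ (f ∘ e.symm) e.target :=
  (hf.comp_contMDiffOn (contMDiffOn_atlas_symm he)).contDiffOn

theorem fderiv_comp_symm {f : Y → ℝ} (hf : ContMDiff (𝓡 m) 𝓘(ℝ, ℝ) ∞ f)
    (he : e ∈ atlas (EuclideanSpace ℝ (Fin m)) Y) (hx : x ∈ e.target)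
    (v : EuclideanSpace ℝ (Fin m)) :
    fderiv ℝ (f ∘ e.symm) x v =
      differential m f (e.symm x) (mfderiv (𝓡 m) (𝓡 m) e.symm x v) := by
  rw [← mfderiv_eq_fderiv, mfderiv_comp x (hf.mdifferentiableAt (by simp))
    (mdifferentiableAt_symm_of_mem_atlas he hx)]
  rfl

/-- Coordinate changes are smooth. -/
theorem contDiffAt_coordChange {e' : OpenPartialHomeomorph Y (EuclideanSpace ℝ (Fin m))}
    (he : e ∈ atlas (EuclideanSpace ℝ (Fin m)) Y) (he' : e' ∈ atlas (EuclideanSpace ℝ (Fin m)) Y)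
    (hx : x ∈ e.target) (hx' : e.symm x ∈ e'.source) : ContDiffAt ℝ ∞ (e' ∘ e.symm) x := by
  have h1 : ContMDiffAt (𝓡 m) (𝓡 m) ∞ e' (e.symm x) :=
    contMDiffAt_of_mem_maximalAtlas (IsManifold.subset_maximalAtlas he') hx'
  have h2 := (contMDiffOn_atlas_symm he).contMDiffAt (e.open_target.mem_nhds hx)
  exact (h1.comp x h2).contDiffAt

end Charts

section Immersion

variable {m d : ℕ} {Y : Type*} [EMetricSpace Y] [ChartedSpace (EuclideanSpace ℝ (Fin m)) Y]
  [RiemannianBundle (fun y : Y ↦ TangentSpace (𝓡 m) y)] {ι : Y → EuclideanSpace ℝ (Fin d)}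
  {e : OpenPartialHomeomorph Y (EuclideanSpace ℝ (Fin m))} {x : EuclideanSpace ℝ (Fin m)}

namespace IsIsometricImmersion

theorem pushforward_eq (hι : IsIsometricImmersion m ι) (y : Y) :
    pushforward ι y = fderiv ℝ (ι ∘ (chartAt (EuclideanSpace ℝ (Fin m)) y).symm)
      (chartAt (EuclideanSpace ℝ (Fin m)) y y) :=
  mfderiv_eq_fderiv_chartAt (hι.smooth.mdifferentiableAt (by simp))

variable [IsManifold (𝓡 m) ∞ Y]

theorem fderiv_comp_symm (hι : IsIsometricImmersion m ι)
    (he : e ∈ atlas (EuclideanSpace ℝ (Fin m)) Y) (hx : x ∈ e.target)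
    (v : EuclideanSpace ℝ (Fin m)) :
    fderiv ℝ (ι ∘ e.symm) x v = pushforward ι (e.symm x) (mfderiv (𝓡 m) (𝓡 m) e.symm x v) := by
  rw [← mfderiv_eq_fderiv, mfderiv_comp x (hι.smooth.mdifferentiableAt (by simp))
    (mdifferentiableAt_symm_of_mem_atlas he hx)]
  rfl

theorem isHypImmersionOn (hι : IsIsometricImmersion m ι)
    (he : e ∈ atlas (EuclideanSpace ℝ (Fin m)) Y) : IsHypImmersionOn e.target (ι ∘ e.symm) where
  isOpen := e.open_target
  contDiffOn := (hι.smooth.comp_contMDiffOn (contMDiffOn_atlas_symm he)).contDiffOn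
  mem_ball x _ := hι.mem_ball _
  injective x hx v w hvw := by
    rw [hι.fderiv_comp_symm he hx, hι.fderiv_comp_symm he hx] at hvw
    exact injective_mfderiv_symm he hx (hι.injective _ hvw)

theorem inducedMetric_eq_inner (hι : IsIsometricImmersion m ι)
    (he : e ∈ atlas (EuclideanSpace ℝ (Fin m)) Y) (hx : x ∈ e.target)
    (v w : EuclideanSpace ℝ (Fin m)) :
    inducedMetric (ι ∘ e.symm) x v w =
      ⟪mfderiv (𝓡 m) (𝓡 m) e.symm x v, mfderiv (𝓡 m) (𝓡 m) e.symm x w⟫_ℝ := by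
  rw [hι.inner_eq, ← hι.fderiv_comp_symm he hx, ← hι.fderiv_comp_symm he hx]
  rfl

theorem chartGram_eq (hι : IsIsometricImmersion m ι)
    (he : e ∈ atlas (EuclideanSpace ℝ (Fin m)) Y) (hx : x ∈ e.target) :
    chartGram e x = inducedGram (ι ∘ e.symm) x := by
  ext i j
  exact (hι.inducedMetric_eq_inner he hx _ _).symm

theorem sqrt_det_chartGram (hι : IsIsometricImmersion m ι)
    (he : e ∈ atlas (EuclideanSpace ℝ (Fin m)) Y) {x : EuclideanSpace ℝ (Fin m)}
    (hx : x ∈ e.target) : √(chartGram e x).det = volumeDensity (ι ∘ e.symm) x := by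
  rw [volumeDensity, hι.chartGram_eq he hx]

end IsIsometricImmersion

/-- The tangential part along `ι` of the radial field, as a vector field on the submanifold: it is
given by its coordinates in the preferred chart at each point. -/
noncomputable def submanifoldField (ι : Y → EuclideanSpace ℝ (Fin d)) (y : Y) :
    TangentSpace (𝓡 m) y :=
  tangentialField (ι ∘ (chartAt (EuclideanSpace ℝ (Fin m)) y).symm)
    (chartAt (EuclideanSpace ℝ (Fin m)) y y)

namespace IsIsometricImmersion

variable [IsManifold (𝓡 m) ∞ Y]

theorem inner_submanifoldField (hι : IsIsometricImmersion m ι) (y : Y) (v : TangentSpace (𝓡 m) y) :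
    ⟪v, submanifoldField ι y⟫_ℝ = hypInner (ι y) (radialField (ι y)) (pushforward ι y v) := by
  have h := (hι.isHypImmersionOn (chart_mem_atlas _ y)).inducedMetric_tangentialField
    (mem_chart_target _ y) v
  have hy : (ι ∘ (chartAt (EuclideanSpace ℝ (Fin m)) y).symm)
      (chartAt (EuclideanSpace ℝ (Fin m)) y y) = ι y :=
    congrArg ι ((chartAt _ y).left_inv (mem_chart_source _ y))
  refine (hι.inner_eq y v (submanifoldField ι y)).trans ?_
  rw [hι.pushforward_eq y, ← hy]
  exact h

theorem norm_submanifoldField_le_one (hι : IsIsometricImmersion m ι) (y : Y) :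
    ‖submanifoldField (m := m) ι y‖ ≤ 1 := by
  have h1 : ‖submanifoldField (m := m) ι y‖ ^ 2 =
      hypInner (ι y) (radialField (ι y)) (pushforward ι y (submanifoldField (m := m) ι y)) := by
    rw [← hι.inner_submanifoldField, real_inner_self_eq_norm_sq]
  have h2 := (le_abs_self _).trans
    (abs_hypInner_le (ι y) (radialField (ι y)) (pushforward ι y (submanifoldField (m := m) ι y)))
  have h3 : hypNorm (ι y) (pushforward ι y (submanifoldField (m := m) ι y)) =
      ‖submanifoldField (m := m) ι y‖ := by
    rw [hypNorm, ← hι.inner_eq, real_inner_self_eq_norm_sq, Real.sqrt_sq (norm_nonneg _)]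
  have h4 : hypNorm (ι y) (radialField (ι y)) ≤ 1 :=
    Real.sqrt_le_one.2 (hypInner_radialField_self_le_one (hι.mem_ball y))
  rw [h3, ← h1] at h2
  nlinarith [norm_nonneg (submanifoldField (m := m) ι y)]

theorem mfderiv_symm_tangentialField (hι : IsIsometricImmersion m ι)
    (he : e ∈ atlas (EuclideanSpace ℝ (Fin m)) Y) (hx : x ∈ e.target) :
    mfderiv (𝓡 m) (𝓡 m) e.symm x (tangentialField (ι ∘ e.symm) x) =
      submanifoldField ι (e.symm x) := by
  refine ext_inner_left ℝ fun v' ↦ ?_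
  obtain ⟨v, rfl⟩ : ∃ v : EuclideanSpace ℝ (Fin m), mfderiv (𝓡 m) (𝓡 m) e.symm x v = v' :=
    surjective_mfderiv_symm he hx v'
  refine (hι.inducedMetric_eq_inner he hx v _).symm.trans
    (((hι.isHypImmersionOn he).inducedMetric_tangentialField hx v).trans ?_)
  rw [hι.fderiv_comp_symm he hx]
  exact (hι.inner_submanifoldField _ _).symm

theorem differential_submanifoldField (hι : IsIsometricImmersion m ι)
    (he : e ∈ atlas (EuclideanSpace ℝ (Fin m)) Y) (hx : x ∈ e.target) {f : Y → ℝ}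
    (hf : ContMDiff (𝓡 m) 𝓘(ℝ, ℝ) ∞ f) :
    differential m f (e.symm x) (submanifoldField ι (e.symm x)) =
      fderiv ℝ (f ∘ e.symm) x (tangentialField (ι ∘ e.symm) x) := by
  rw [← hι.mfderiv_symm_tangentialField he hx, _root_.fderiv_comp_symm hf he hx]

theorem continuous_differential_submanifoldField (hι : IsIsometricImmersion m ι) {f : Y → ℝ}
    (hf : ContMDiff (𝓡 m) 𝓘(ℝ, ℝ) ∞ f) :
    Continuous fun y ↦ differential m f y (submanifoldField ι y) := by
  rw [continuous_iff_continuousAt]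
  intro y
  set e := chartAt (EuclideanSpace ℝ (Fin m)) y
  have he : e ∈ atlas (EuclideanSpace ℝ (Fin m)) Y := chart_mem_atlas _ y
  have hy : e y ∈ e.target := mem_chart_target _ y
  have h1 : ContinuousAt (fun x ↦ fderiv ℝ (f ∘ e.symm) x (tangentialField (ι ∘ e.symm) x)) (e y) :=
    ((((contDiffOn_comp_symm hf he).contDiffAt (e.open_target.mem_nhds hy)).fderiv_right
      (m := 0) (by simp)).continuousAt).clm_apply
      ((hι.isHypImmersionOn he).contDiffAt_tangentialField hy).continuousAt
  refine (h1.comp (e.continuousAt (mem_chart_source _ y))).congr ?_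
  filter_upwards [e.open_source.mem_nhds (mem_chart_source _ y)] with z hz
  have := hι.differential_submanifoldField he (e.map_source hz) hf
  rw [e.left_inv hz] at this
  exact this.symm

end IsIsometricImmersion

end Immersion

/-! ### The mean curvature in a chart -/

section MeanCurvature

variable {m d : ℕ}

theorem starProjection_congr {E : Type*} [NormedAddCommGroup E] [InnerProductSpace ℝ E]
    {K K' : Submodule ℝ E} [K.HasOrthogonalProjection] [K'.HasOrthogonalProjection] (h : K = K')
    (v : E) : K.starProjection v = K'.starProjection v := by
  subst h
  rfl

/-- Transformation of the covariant Hessian under a change of coordinates `T`: the terms with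
second derivatives of `T` are tangential. -/
theorem covariantHessian_comp {F : EuclideanSpace ℝ (Fin m) → EuclideanSpace ℝ (Fin d)}
    {T : EuclideanSpace ℝ (Fin m) → EuclideanSpace ℝ (Fin m)} {x : EuclideanSpace ℝ (Fin m)}
    (hF : ContDiffAt ℝ ∞ F (T x)) (hT : ContDiffAt ℝ ∞ T x) (v w : EuclideanSpace ℝ (Fin m)) :
    covariantHessian (F ∘ T) x v w = covariantHessian F (T x) (fderiv ℝ T x v) (fderiv ℝ T x w) +
      fderiv ℝ F (T x) (fderiv ℝ (fderiv ℝ T) x v w) := by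
  have hd : ∀ {p q : ℕ} {G : EuclideanSpace ℝ (Fin p) → EuclideanSpace ℝ (Fin q)}
      {z : EuclideanSpace ℝ (Fin p)}, ContDiffAt ℝ ∞ G z → HasFDerivAt G (fderiv ℝ G z) z :=
    fun h ↦ (h.differentiableAt (by simp)).hasFDerivAt
  have hev : ∀ᶠ z in 𝓝 x, ContDiffAt ℝ 1 F (T z) ∧ ContDiffAt ℝ 1 T z := by
    have h1 : (1 : WithTop ℕ∞) ≤ (∞ : WithTop ℕ∞) := WithTop.coe_le_coe.2 le_top
    exact (hT.continuousAt.eventually ((hF.of_le h1).eventually (by simp))).and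
      ((hT.of_le h1).eventually (by simp))
  have h1 : fderiv ℝ (F ∘ T) =ᶠ[𝓝 x] fun z ↦ (fderiv ℝ F (T z)).comp (fderiv ℝ T z) := by
    filter_upwards [hev] with z hz
    exact fderiv_comp z (hz.1.differentiableAt one_ne_zero) (hz.2.differentiableAt one_ne_zero)
  have hF2 : HasFDerivAt (fderiv ℝ F) (fderiv ℝ (fderiv ℝ F) (T x)) (T x) :=
    ((hF.fderiv_right (m := ∞) (by simp)).differentiableAt (by simp)).hasFDerivAt
  have hT2 : HasFDerivAt (fderiv ℝ T) (fderiv ℝ (fderiv ℝ T) x) x :=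
    ((hT.fderiv_right (m := ∞) (by simp)).differentiableAt (by simp)).hasFDerivAt
  have h2 := ((hF2.comp x (hd hT)).clm_comp hT2).fderiv
  rw [covariantHessian, h1.fderiv_eq, h1.self_of_nhds]
  have h3 : fderiv ℝ (fun z ↦ (fderiv ℝ F (T z)).comp (fderiv ℝ T z)) x = _ := h2
  rw [h3, covariantHessian]
  simp
  abel

variable {Y : Type*} [EMetricSpace Y] [ChartedSpace (EuclideanSpace ℝ (Fin m)) Y]
  [IsManifold (𝓡 m) ∞ Y] [RiemannianBundle (fun y : Y ↦ TangentSpace (𝓡 m) y)]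
  {ι : Y → EuclideanSpace ℝ (Fin d)}
  {e : OpenPartialHomeomorph Y (EuclideanSpace ℝ (Fin m))} {x : EuclideanSpace ℝ (Fin m)}

namespace IsIsometricImmersion

theorem normalSpace_eq (hι : IsIsometricImmersion m ι)
    (he : e ∈ atlas (EuclideanSpace ℝ (Fin m)) Y) (hx : x ∈ e.target) :
    (fderiv ℝ (ι ∘ e.symm) x).toLinearMap.rangeᗮ = normalSpace (m := m) ι (e.symm x) := by
  rw [normalSpace]
  congr 1
  ext w
  constructor
  · rintro ⟨v, rfl⟩
    exact ⟨mfderiv (𝓡 m) (𝓡 m) e.symm x v, (hι.fderiv_comp_symm he hx v).symm⟩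
  · rintro ⟨v, rfl⟩
    obtain ⟨v, rfl⟩ := surjective_mfderiv_symm he hx v
    exact ⟨v, hι.fderiv_comp_symm he hx v⟩

/-- The second fundamental form is the normal part of the covariant Hessian of `ι` in any chart. -/
theorem starProjection_covariantHessian (hι : IsIsometricImmersion m ι)
    (he : e ∈ atlas (EuclideanSpace ℝ (Fin m)) Y) (hx : x ∈ e.target)
    (v w : EuclideanSpace ℝ (Fin m)) :
    (fderiv ℝ (ι ∘ e.symm) x).toLinearMap.rangeᗮ.starProjection
        (covariantHessian (ι ∘ e.symm) x v w) =
      secondFundamentalForm ι (e.symm x) (mfderiv (𝓡 m) (𝓡 m) e.symm x v)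
        (mfderiv (𝓡 m) (𝓡 m) e.symm x w) := by
  set y := e.symm x with hy
  set e' := chartAt (EuclideanSpace ℝ (Fin m)) y with he'
  have hs : y ∈ e'.source := mem_chart_source _ y
  have hF : ContDiffAt ℝ ∞ (ι ∘ e'.symm) ((e' ∘ e.symm) x) :=
    (hι.isHypImmersionOn (chart_mem_atlas _ y)).contDiffAt (mem_chart_target _ y)
  have hT : ContDiffAt ℝ ∞ (e' ∘ e.symm) x := contDiffAt_coordChange he (chart_mem_atlas _ y) hx hs
  have hcov : covariantHessian (ι ∘ e.symm) x v w =
      covariantHessian (ι ∘ e'.symm) (e' y) (mfderiv (𝓡 m) (𝓡 m) e.symm x v)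
        (mfderiv (𝓡 m) (𝓡 m) e.symm x w) +
      pushforward ι y (fderiv ℝ (fderiv ℝ (e' ∘ e.symm)) x v w) := by
    have hcongr := comp_symm_eventuallyEq ι (e' := e') hx hs
    have h1 : covariantHessian (ι ∘ e.symm) x =
        covariantHessian ((ι ∘ e'.symm) ∘ (e' ∘ e.symm)) x := by
      funext v w
      rw [covariantHessian, covariantHessian, hcongr.fderiv.fderiv_eq, hcongr.fderiv_eq,
        hcongr.self_of_nhds]
    rw [h1, covariantHessian_comp hF hT, hι.pushforward_eq, mfderiv_symm_eq_fderiv he hx]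
    rfl
  rw [hcov, map_add, starProjection_congr (hι.normalSpace_eq he hx),
    starProjection_congr (hι.normalSpace_eq he hx)]
  have h0 : (normalSpace (m := m) ι y).starProjection
      (pushforward ι y (fderiv ℝ (fderiv ℝ (e' ∘ e.symm)) x v w)) = 0 := by
    rw [Submodule.starProjection_apply_eq_zero_iff]
    exact Submodule.le_orthogonal_orthogonal _ ⟨_, rfl⟩
  have hιy : (ι ∘ e'.symm) (e' y) = ι y := congrArg ι (e'.left_inv hs)
  rw [h0, add_zero, secondFundamentalForm, hι.pushforward_eq, ← hιy]
  rfl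

/-- In any chart, the normal part of the trace of the covariant Hessian is the mean curvature
vector. -/
theorem exists_isInducedFrame (hι : IsIsometricImmersion m ι)
    (he : e ∈ atlas (EuclideanSpace ℝ (Fin m)) Y) (hx : x ∈ e.target) :
    ∃ β : Fin m → EuclideanSpace ℝ (Fin m), IsInducedFrame (ι ∘ e.symm) x β ∧
      (fderiv ℝ (ι ∘ e.symm) x).toLinearMap.rangeᗮ.starProjection
        (∑ a, covariantHessian (ι ∘ e.symm) x (β a) (β a)) = meanCurvature m ι (e.symm x) := by
  let : FiniteDimensional ℝ (TangentSpace (𝓡 m) (e.symm x)) :=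
    inferInstanceAs (FiniteDimensional ℝ (EuclideanSpace ℝ (Fin m)))
  have hdim : Module.finrank ℝ (TangentSpace (𝓡 m) (e.symm x)) = m :=
    finrank_euclideanSpace_fin (𝕜 := ℝ) (n := m)
  set b := stdOrthonormalBasis ℝ (TangentSpace (𝓡 m) (e.symm x)) with hb
  choose β hβ using fun a : Fin m ↦ surjective_mfderiv_symm he hx (b (finCongr hdim.symm a))
  refine ⟨β, fun a c ↦ ?_, ?_⟩
  · refine (hι.inducedMetric_eq_inner he hx (β a) (β c)).trans ?_
    rw [hβ, hβ, orthonormal_iff_ite.1 b.orthonormal, Matrix.one_apply]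
    simp
  · rw [map_sum, meanCurvature, ← (finCongr hdim.symm).sum_comp]
    refine Finset.sum_congr rfl fun a _ ↦ ?_
    refine (hι.starProjection_covariantHessian he hx (β a) (β a)).trans ?_
    rw [hβ]

end IsIsometricImmersion

end MeanCurvature

/-! ### The Riemannian volume in a chart -/

section CoordinateChange

variable {m d : ℕ}

/-- Transformation of the volume density under a change of coordinates `T`. -/
theorem volumeDensity_comp {F F' : EuclideanSpace ℝ (Fin m) → EuclideanSpace ℝ (Fin d)}
    {T : EuclideanSpace ℝ (Fin m) → EuclideanSpace ℝ (Fin m)} {x : EuclideanSpace ℝ (Fin m)}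
    (hF' : F' =ᶠ[𝓝 x] F ∘ T) (hF : DifferentiableAt ℝ F (T x)) (hT : DifferentiableAt ℝ T x) :
    volumeDensity F' x = |(fderiv ℝ T x).det| * volumeDensity F (T x) := by
  set J := Matrix.of fun i a ↦ fderiv ℝ T x (EuclideanSpace.single i 1) a with hJ
  have hdet : (fderiv ℝ T x).det = J.det := by
    rw [ContinuousLinearMap.det,
      ← LinearMap.det_toMatrix (EuclideanSpace.basisFun (Fin m) ℝ).toBasis, ← Matrix.det_transpose]
    congr 1
  have hgram : inducedGram F' x = J * inducedGram F (T x) * J.transpose := by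
    ext i j
    have h1 : inducedGram F' x i j = inducedMetric F (T x)
        (fderiv ℝ T x (EuclideanSpace.single i 1)) (fderiv ℝ T x (EuclideanSpace.single j 1)) := by
      simp only [inducedGram, inducedMetric, Matrix.of_apply, hF'.fderiv_eq, hF'.self_of_nhds,
        fderiv_comp x hF hT]
      rfl
    rw [h1, inducedMetric_eq_dotProduct, Matrix.mul_assoc]
    simp [hJ, Matrix.mul_apply, dotProduct, Matrix.mulVec]
  rw [volumeDensity, hgram, Matrix.det_mul, Matrix.det_mul, Matrix.det_transpose, hdet,
    mul_right_comm, Real.sqrt_mul (mul_self_nonneg _), Real.sqrt_mul_self_eq_abs]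
  rfl

end CoordinateChange

section Volume

theorem measurableSet_target_inter_preimage {X E : Type*} [TopologicalSpace X] [MeasurableSpace X]
    [BorelSpace X] [TopologicalSpace E] [MeasurableSpace E] [BorelSpace E]
    (e : OpenPartialHomeomorph X E) {A : Set X} (hA : MeasurableSet A) :
    MeasurableSet (e.target ∩ e.symm ⁻¹' A) := by
  have h := (continuousOn_iff_continuous_domRestrict.1 e.continuousOn_symm).measurable hA
  have := e.open_target.measurableSet.subtype_image h
  rwa [Set.domRestrict_eq, Set.preimage_comp, Subtype.image_preimage_coe] at this

variable {m d : ℕ} {Y : Type*} [EMetricSpace Y] [ChartedSpace (EuclideanSpace ℝ (Fin m)) Y]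
  [RiemannianBundle (fun y : Y ↦ TangentSpace (𝓡 m) y)] [MeasurableSpace Y] [BorelSpace Y]
  {e : OpenPartialHomeomorph Y (EuclideanSpace ℝ (Fin m))}

theorem aemeasurable_symm (e : OpenPartialHomeomorph Y (EuclideanSpace ℝ (Fin m))) :
    AEMeasurable e.symm
      (((volume : Measure (EuclideanSpace ℝ (Fin m))).restrict e.target).withDensity
        fun x ↦ ENNReal.ofReal (√(chartGram e x).det)) :=
  (e.continuousOn_symm.aemeasurable e.open_target.measurableSet).mono_ac
    (withDensity_absolutelyContinuous _ _)

theorem chartVolume_apply (e : OpenPartialHomeomorph Y (EuclideanSpace ℝ (Fin m))) {A : Set Y}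
    (hA : MeasurableSet A) : chartVolume e A =
      ∫⁻ x in e.target ∩ e.symm ⁻¹' A, ENNReal.ofReal (√(chartGram e x).det) := by
  have hs := measurableSet_target_inter_preimage e hA
  rw [chartVolume, Measure.map_apply_of_aemeasurable (aemeasurable_symm e) hA]
  have hae : (e.symm ⁻¹' A : Set (EuclideanSpace ℝ (Fin m))) =ᵐ[
      ((volume : Measure (EuclideanSpace ℝ (Fin m))).restrict e.target).withDensity
        fun x ↦ ENNReal.ofReal (√(chartGram e x).det)] (e.target ∩ e.symm ⁻¹' A : Set _) := by
    refine (withDensity_absolutelyContinuous _ _).ae_le ?_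
    filter_upwards [ae_restrict_mem e.open_target.measurableSet] with x hx
    exact propext ⟨fun h ↦ ⟨hx, h⟩, fun h ↦ h.2⟩
  rw [measure_congr hae, withDensity_apply _ hs, Measure.restrict_restrict hs,
    inter_right_comm, inter_self]

variable [IsManifold (𝓡 m) ∞ Y] {ι : Y → EuclideanSpace ℝ (Fin d)}

namespace IsIsometricImmersion

/-- The chart measures agree on overlaps, by the change of variables formula. -/
theorem chartVolume_inter_source_le (hι : IsIsometricImmersion m ι)
    {e' : OpenPartialHomeomorph Y (EuclideanSpace ℝ (Fin m))}
    (he : e ∈ atlas (EuclideanSpace ℝ (Fin m)) Y) (he' : e' ∈ atlas (EuclideanSpace ℝ (Fin m)) Y)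
    {A : Set Y} (hA : MeasurableSet A) : chartVolume e' (A ∩ e.source) ≤ chartVolume e A := by
  have hAs : MeasurableSet (A ∩ e.source) := hA.inter e.open_source.measurableSet
  rw [chartVolume_apply e' hAs, chartVolume_apply e hA]
  set s := e'.target ∩ e'.symm ⁻¹' (A ∩ e.source) with hs
  have hT : ∀ x ∈ s, HasFDerivAt (e ∘ e'.symm) (fderiv ℝ (e ∘ e'.symm) x) x := fun x hx ↦
    ((contDiffAt_coordChange he' he hx.1 hx.2.2).differentiableAt (by simp)).hasFDerivAt
  have hinj : InjOn (e ∘ e'.symm) s := fun x hx z hz hxz ↦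
    e'.symm.injOn hx.1 hz.1 (e.injOn hx.2.2 hz.2.2 hxz)
  have hsub : (e ∘ e'.symm) '' s ⊆ e.target ∩ e.symm ⁻¹' A := by
    rintro _ ⟨x, hx, rfl⟩
    refine ⟨e.map_source hx.2.2, ?_⟩
    rw [mem_preimage, Function.comp_apply, e.left_inv hx.2.2]
    exact hx.2.1
  refine le_trans (le_of_eq ?_) (lintegral_mono_set hsub)
  have hsm := measurableSet_target_inter_preimage e' hAs
  rw [lintegral_image_eq_lintegral_abs_det_fderiv_mul volume hsm
    (fun x hx ↦ (hT x hx).hasFDerivWithinAt) hinj]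
  refine setLIntegral_congr_fun hsm fun x hx ↦ ?_
  have hx2 : e (e'.symm x) ∈ e.target := e.map_source hx.2.2
  beta_reduce
  rw [Function.comp_apply, hι.sqrt_det_chartGram he' hx.1, hι.sqrt_det_chartGram he hx2,
    ← ENNReal.ofReal_mul (abs_nonneg _)]
  congr 1
  exact volumeDensity_comp (comp_symm_eventuallyEq ι hx.1 hx.2.2)
    ((hι.isHypImmersionOn he).hasFDerivAt hx2).differentiableAt (hT x hx).differentiableAt

/-- On the domain of a chart `e`, the Riemannian volume is `√(det gᵢⱼ) dx`. -/
theorem riemannianVolume_restrict_source (hι : IsIsometricImmersion m ι)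
    (he : e ∈ atlas (EuclideanSpace ℝ (Fin m)) Y) :
    (riemannianVolume m Y).restrict e.source = chartVolume e := by
  have hes := e.open_source.measurableSet
  have hcompl : chartVolume e e.sourceᶜ = 0 := by
    rw [chartVolume_apply e hes.compl]
    have : e.target ∩ e.symm ⁻¹' e.sourceᶜ = ∅ := by
      ext x
      simp only [mem_inter_iff, mem_preimage, mem_compl_iff, mem_empty_iff_false, iff_false,
        not_and, not_not]
      exact e.map_target
    rw [this, setLIntegral_empty]
  have hle : chartVolume e ≤ riemannianVolume m Y := le_iSup₂_of_le e he le_rfl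
  refine le_antisymm ?_ ?_
  · -- all chart measures are dominated by the one of `e` on the source of `e`
    have hdom : riemannianVolume m Y ≤
        chartVolume e + (riemannianVolume m Y).restrict e.sourceᶜ := by
      refine iSup₂_le fun e' he' ↦ Measure.le_iff.2 fun A hA ↦ ?_
      rw [Measure.add_apply, Measure.restrict_apply hA, ← measure_inter_add_sdiff A hes]
      refine add_le_add (hι.chartVolume_inter_source_le he he' hA) ?_
      exact (le_iSup₂_of_le
        (f := fun e (_ : e ∈ atlas (EuclideanSpace ℝ (Fin m)) Y) ↦ chartVolume e) e' he' le_rfl :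
          chartVolume e' ≤ riemannianVolume m Y) _
    refine Measure.le_iff.2 fun A hA ↦ ?_
    rw [Measure.restrict_apply hA]
    refine (hdom _).trans ?_
    rw [Measure.add_apply, Measure.restrict_apply (hA.inter hes), inter_assoc, inter_compl_self,
      inter_empty, measure_empty, add_zero]
    exact measure_mono inter_subset_left
  · refine Measure.le_iff.2 fun A hA ↦ ?_
    rw [Measure.restrict_apply hA, ← measure_inter_add_sdiff A hes,
      measure_mono_null (sdiff_subset_compl A e.source) hcompl, add_zero]
    exact hle _

theorem isLocallyFiniteMeasure_riemannianVolume (hι : IsIsometricImmersion m ι) :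
    IsLocallyFiniteMeasure (riemannianVolume m Y) := by
  refine ⟨fun y ↦ ?_⟩
  set e := chartAt (EuclideanSpace ℝ (Fin m)) y
  have he : e ∈ atlas (EuclideanSpace ℝ (Fin m)) Y := chart_mem_atlas _ y
  have hy : y ∈ e.source := mem_chart_source _ y
  obtain ⟨K, hK, hyK, hKt⟩ := exists_compact_subset e.open_target (e.map_source hy)
  have himg : e.symm '' K = e.source ∩ e ⁻¹' K := e.symm.image_eq_target_inter_inv_preimage hKt
  refine ⟨e.symm '' K, ?_, ?_⟩
  · rw [himg]
    exact Filter.inter_mem (e.open_source.mem_nhds hy)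
      ((e.continuousAt hy).preimage_mem_nhds (mem_interior_iff_mem_nhds.1 hyK))
  · have hms : MeasurableSet (e.symm '' K) :=
      (hK.image_of_continuousOn (e.continuousOn_symm.mono hKt)).isClosed.measurableSet
    have h1 : riemannianVolume m Y (e.symm '' K) = chartVolume e (e.symm '' K) := by
      rw [← hι.riemannianVolume_restrict_source he, Measure.restrict_apply hms,
        inter_eq_left.2 (himg ▸ inter_subset_left)]
    have h2 : e.target ∩ e.symm ⁻¹' (e.symm '' K) = K := by
      ext x
      refine ⟨?_, fun hx ↦ ⟨hKt hx, mem_image_of_mem _ hx⟩⟩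
      rintro ⟨hx, z, hz, hzx⟩
      rwa [← e.symm.injOn (hKt hz) hx hzx]
    rw [h1, chartVolume_apply e hms, h2]
    have hJ : ContinuousOn (volumeDensity (ι ∘ e.symm)) K := fun x hx ↦
      ((hι.isHypImmersionOn he).contDiffAt_volumeDensity (hKt hx)).continuousAt.continuousWithinAt
    refine lt_of_eq_of_lt (setLIntegral_congr_fun hK.measurableSet fun x hx ↦ ?_)
      (hJ.integrableOn_compact hK).lintegral_lt_top
    rw [hι.sqrt_det_chartGram he (hKt hx)]

/-- Integration in a chart. -/
theorem integral_eq_of_support_subset (hι : IsIsometricImmersion m ι)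
    (he : e ∈ atlas (EuclideanSpace ℝ (Fin m)) Y) {q : Y → ℝ} (hq : Continuous q)
    (hs : Function.support q ⊆ e.source) :
    ∫ y, q y ∂(riemannianVolume m Y) =
      ∫ x in e.target, q (e.symm x) * volumeDensity (ι ∘ e.symm) x := by
  have hJ : AEMeasurable (fun x ↦ ENNReal.ofReal (√(chartGram e x).det))
      ((volume : Measure (EuclideanSpace ℝ (Fin m))).restrict e.target) := by
    have hc : ContinuousOn (volumeDensity (ι ∘ e.symm)) e.target := fun x hx ↦
      ((hι.isHypImmersionOn he).contDiffAt_volumeDensity hx).continuousAt.continuousWithinAt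
    refine ((hc.aemeasurable e.open_target.measurableSet).ennreal_ofReal).congr ?_
    filter_upwards [ae_restrict_mem e.open_target.measurableSet] with x hx
    rw [hι.sqrt_det_chartGram he hx]
  rw [← setIntegral_eq_integral_of_forall_compl_eq_zero
    (fun y hy ↦ Function.notMem_support.1 fun h ↦ hy (hs h)),
    hι.riemannianVolume_restrict_source he, chartVolume,
    integral_map (aemeasurable_symm e) hq.aestronglyMeasurable,
    integral_withDensity_eq_integral_toReal_smul₀ hJ (ae_of_all _ fun x ↦ ENNReal.ofReal_lt_top)]
  refine setIntegral_congr_fun e.open_target.measurableSet fun x hx ↦ ?_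
  rw [ENNReal.toReal_ofReal (Real.sqrt_nonneg _), hι.sqrt_det_chartGram he hx, smul_eq_mul,
    mul_comm]

end IsIsometricImmersion

end Volume

/-! ### The spectral bound for smooth functions -/

section SpectralBound

variable {m d : ℕ} {Y : Type*} [EMetricSpace Y]

/-- The coordinate expression, extended by zero, of a function supported in a chart. -/
noncomputable def chartExtension (e : OpenPartialHomeomorph Y (EuclideanSpace ℝ (Fin m)))
    (f : Y → ℝ) : EuclideanSpace ℝ (Fin m) → ℝ :=
  e.target.indicator (f ∘ e.symm)

section Extension

variable {e : OpenPartialHomeomorph Y (EuclideanSpace ℝ (Fin m))} {f : Y → ℝ}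

theorem tsupport_chartExtension_subset (hc : HasCompactSupport f) (hs : tsupport f ⊆ e.source) :
    tsupport (chartExtension e f) ⊆ e '' tsupport f := by
  refine closure_minimal (fun x hx ↦ ?_)
    ((hc.isCompact.image_of_continuousOn (e.continuousOn.mono hs)).isClosed)
  have hxt : x ∈ e.target := Set.mem_of_indicator_ne_zero hx
  rw [Function.mem_support, chartExtension, indicator_of_mem hxt] at hx
  exact ⟨e.symm x, subset_tsupport f hx, e.right_inv hxt⟩

theorem tsupport_chartExtension_subset_target (hc : HasCompactSupport f)
    (hs : tsupport f ⊆ e.source) : tsupport (chartExtension e f) ⊆ e.target := by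
  refine (tsupport_chartExtension_subset hc hs).trans ?_
  rintro _ ⟨y, hy, rfl⟩
  exact e.map_source (hs hy)

theorem hasCompactSupport_chartExtension (hc : HasCompactSupport f) (hs : tsupport f ⊆ e.source) :
    HasCompactSupport (chartExtension e f) :=
  (hc.isCompact.image_of_continuousOn (e.continuousOn.mono hs)).of_isClosed_subset
    (isClosed_tsupport _) (tsupport_chartExtension_subset hc hs)

theorem chartExtension_eventuallyEq {x : EuclideanSpace ℝ (Fin m)} (hx : x ∈ e.target) :
    chartExtension e f =ᶠ[𝓝 x] f ∘ e.symm := by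
  filter_upwards [e.open_target.mem_nhds hx] with z hz
  exact indicator_of_mem hz _

theorem contDiff_chartExtension [ChartedSpace (EuclideanSpace ℝ (Fin m)) Y]
    [IsManifold (𝓡 m) ∞ Y] (hf : ContMDiff (𝓡 m) 𝓘(ℝ, ℝ) ∞ f)
    (he : e ∈ atlas (EuclideanSpace ℝ (Fin m)) Y) (hc : HasCompactSupport f)
    (hs : tsupport f ⊆ e.source) : ContDiff ℝ ∞ (chartExtension e f) := by
  rw [contDiff_iff_contDiffAt]
  intro x
  by_cases hx : x ∈ e.target
  · exact ((contDiffOn_comp_symm hf he).contDiffAt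
      (e.open_target.mem_nhds hx)).congr_of_eventuallyEq (chartExtension_eventuallyEq hx)
  · have : chartExtension e f =ᶠ[𝓝 x] fun _ ↦ 0 := notMem_tsupport_iff_eventuallyEq.1 fun h ↦
      hx (tsupport_chartExtension_subset_target hc hs h)
    exact contDiffAt_const.congr_of_eventuallyEq this

end Extension

variable [ChartedSpace (EuclideanSpace ℝ (Fin m)) Y]

theorem differential_eq_zero_of_notMem_tsupport {f : Y → ℝ} {y : Y} (hy : y ∉ tsupport f) :
    differential m f y = 0 := by
  have h0 : f =ᶠ[𝓝 y] fun _ ↦ 0 := notMem_tsupport_iff_eventuallyEq.1 hy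
  have h1 : mfderiv (𝓡 m) 𝓘(ℝ, ℝ) (fun _ : Y ↦ (0 : ℝ)) y = 0 := mfderiv_const
  exact h0.mfderiv_eq.trans h1

variable [IsManifold (𝓡 m) ∞ Y] [RiemannianBundle (fun y : Y ↦ TangentSpace (𝓡 m) y)]
  [MeasurableSpace Y] [BorelSpace Y] {ι : Y → EuclideanSpace ℝ (Fin d)} {α : ℝ}

namespace IsIsometricImmersion

/-- The weak form of `div X ≥ m - 1 - α`, tested against a nonnegative function supported in a
chart. -/
theorem integral_differential_le_of_tsupport_subset (hι : IsIsometricImmersion m ι)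
    (hH : ∀ y : Y, hypNorm (ι y) (meanCurvature m ι y) ≤ α)
    {e : OpenPartialHomeomorph Y (EuclideanSpace ℝ (Fin m))}
    (he : e ∈ atlas (EuclideanSpace ℝ (Fin m)) Y) {ψ : Y → ℝ}
    (hψ : ContMDiff (𝓡 m) 𝓘(ℝ, ℝ) ∞ ψ) (hc : HasCompactSupport ψ) (hs : tsupport ψ ⊆ e.source)
    (h0 : ∀ y, 0 ≤ ψ y) :
    (∫ y, differential m ψ y (submanifoldField ι y) ∂(riemannianVolume m Y)) +
      (m - 1 - α) * ∫ y, ψ y ∂(riemannianVolume m Y) ≤ 0 := by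
  have hF := hι.isHypImmersionOn he
  have hbound : ∀ x ∈ e.target, ∃ β : Fin m → EuclideanSpace ℝ (Fin m),
      IsInducedFrame (ι ∘ e.symm) x β ∧
      hypNorm ((ι ∘ e.symm) x) ((fderiv ℝ (ι ∘ e.symm) x).toLinearMap.rangeᗮ.starProjection
        (∑ a, covariantHessian (ι ∘ e.symm) x (β a) (β a))) ≤ α := fun x hx ↦ by
    obtain ⟨β, hβ, hmean⟩ := hι.exists_isInducedFrame he hx
    exact ⟨β, hβ, by rw [hmean]; exact hH (e.symm x)⟩
  have hmain := hF.integral_fderiv_tangentialField_le hbound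
    ((contDiff_chartExtension hψ he hc hs).of_le (WithTop.coe_le_coe.2 le_top))
    (hasCompactSupport_chartExtension hc hs) (tsupport_chartExtension_subset_target hc hs)
    (fun x ↦ indicator_nonneg (fun z _ ↦ h0 _) x)
  refine le_of_eq_of_le ?_ hmain
  congr 1
  · have hsupp : Function.support (fun y ↦ differential m ψ y (submanifoldField ι y)) ⊆
        e.source := by
      refine Subset.trans (fun y hy ↦ ?_) hs
      by_contra h
      refine hy ?_
      beta_reduce
      rw [differential_eq_zero_of_notMem_tsupport h]
      rfl
    rw [hι.integral_eq_of_support_subset he (hι.continuous_differential_submanifoldField hψ) hsupp]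
    refine Eq.trans ?_ (setIntegral_eq_integral_of_forall_compl_eq_zero (s := e.target) ?_)
    · refine setIntegral_congr_fun e.open_target.measurableSet fun x hx ↦ ?_
      rw [hι.differential_submanifoldField he hx hψ, (chartExtension_eventuallyEq hx).fderiv_eq]
    · intro x hx
      have : fderiv ℝ (chartExtension e ψ) x = 0 := image_eq_zero_of_notMem_tsupport fun h ↦
        hx (tsupport_chartExtension_subset_target hc hs (tsupport_fderiv_subset ℝ h))
      simp [this]
  · congr 1
    rw [hι.integral_eq_of_support_subset he hψ.continuous ((subset_tsupport ψ).trans hs)]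
    refine Eq.trans ?_ (setIntegral_eq_integral_of_forall_compl_eq_zero (s := e.target) ?_)
    · refine setIntegral_congr_fun e.open_target.measurableSet fun x hx ↦ ?_
      rw [(chartExtension_eventuallyEq hx).self_of_nhds]
      rfl
    · intro x hx
      simp [chartExtension, hx]

/-- The weak form of `div X ≥ m - 1 - α`, tested against the square of a smooth function with
compact support: a partition of unity reduces it to functions supported in a chart. -/
theorem integral_sq_le_integral_differential [SecondCountableTopology Y]
    (hι : IsIsometricImmersion m ι)
    (hH : ∀ y : Y, hypNorm (ι y) (meanCurvature m ι y) ≤ α) {φ : Y → ℝ}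
    (hφ : ContMDiff (𝓡 m) 𝓘(ℝ, ℝ) ∞ φ) (hc : HasCompactSupport φ) :
    (m - 1 - α) * ∫ y, φ y ^ 2 ∂(riemannianVolume m Y) ≤
      ∫ y, -(2 * φ y * differential m φ y (submanifoldField ι y)) ∂(riemannianVolume m Y) := by
  have := hι.isLocallyFiniteMeasure_riemannianVolume
  have := ChartedSpace.locallyCompactSpace (EuclideanSpace ℝ (Fin m)) Y
  obtain ⟨ρ, hρ⟩ := SmoothPartitionOfUnity.exists_isSubordinate_chartAt_source (𝓡 m) Y
  have hfin := ρ.locallyFinite.finite_nonempty_inter_compact hc.isCompact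
  set I := hfin.toFinset with hI
  set ψ : Y → Y → ℝ := fun i y ↦ ρ i y * φ y ^ 2 with hψ
  have hψs : ∀ i, ContMDiff (𝓡 m) 𝓘(ℝ, ℝ) ∞ (ψ i) := fun i ↦ (ρ i).contMDiff.mul (hφ.pow 2)
  have hψρ : ∀ i, tsupport (ψ i) ⊆ tsupport (ρ i) := fun i ↦ tsupport_mul_subset_left
  have hψφ : ∀ i, tsupport (ψ i) ⊆ tsupport φ := fun i ↦ closure_mono fun y hy ↦ by
    rw [Function.mem_support] at hy ⊢
    contrapose! hy
    simp [hψ, hy]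
  have hψc : ∀ i, HasCompactSupport (ψ i) := fun i ↦
    hc.isCompact.of_isClosed_subset (isClosed_tsupport _) (hψφ i)
  have hle : ∀ i, (∫ y, differential m (ψ i) y (submanifoldField ι y) ∂(riemannianVolume m Y)) +
      (m - 1 - α) * ∫ y, ψ i y ∂(riemannianVolume m Y) ≤ 0 := fun i ↦
    hι.integral_differential_le_of_tsupport_subset hH (chart_mem_atlas _ i) (hψs i) (hψc i)
      ((hψρ i).trans (hρ i)) fun y ↦ mul_nonneg (ρ.nonneg i y) (sq_nonneg _)
  have hsum : ∀ y, ∑ i ∈ I, ψ i y = φ y ^ 2 := fun y ↦ by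
    simp only [hψ, ← Finset.sum_mul]
    by_cases hy : φ y = 0
    · simp [hy]
    · rw [ρ.sum_finsupport' y (mem_univ y) fun i hi ↦ ?_, one_mul]
      rw [ρ.mem_finsupport] at hi
      exact hfin.mem_toFinset.2 ⟨y, hi, subset_tsupport φ hy⟩
  have hint1 : ∀ i, Integrable (ψ i) (riemannianVolume m Y) := fun i ↦
    (hψs i).continuous.integrable_of_hasCompactSupport (hψc i)
  have hint2 : ∀ i, Integrable (fun y ↦ differential m (ψ i) y (submanifoldField ι y))
      (riemannianVolume m Y) := fun i ↦ by
    refine (hι.continuous_differential_submanifoldField (hψs i)).integrable_of_hasCompactSupport ?_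
    refine HasCompactSupport.intro (hψc i).isCompact fun y hy ↦ ?_
    rw [differential_eq_zero_of_notMem_tsupport hy]
    rfl
  have hdsum : ∀ y, ∑ i ∈ I, differential m (ψ i) y (submanifoldField ι y) =
      2 * φ y * differential m φ y (submanifoldField ι y) := fun y ↦ by
    set e := chartAt (EuclideanSpace ℝ (Fin m)) y with he
    have hye : e.symm (e y) = y := e.left_inv (mem_chart_source _ y)
    have hd : ∀ {f : Y → ℝ}, ContMDiff (𝓡 m) 𝓘(ℝ, ℝ) ∞ f →
        HasFDerivAt (f ∘ e.symm) (fderiv ℝ (f ∘ e.symm) (e y)) (e y) := fun hf ↦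
      (((contDiffOn_comp_symm hf (chart_mem_atlas _ y)).contDiffAt
        (e.open_target.mem_nhds (mem_chart_target _ y))).differentiableAt (by simp)).hasFDerivAt
    have h1 := HasFDerivAt.fun_sum fun i (_ : i ∈ I) ↦ hd (hψs i)
    have h2 : HasFDerivAt (fun x ↦ ∑ i ∈ I, (ψ i ∘ e.symm) x) _ (e y) :=
      ((hd hφ).pow 2).congr_of_eventuallyEq (Eventually.of_forall fun x ↦ hsum (e.symm x))
    let v : EuclideanSpace ℝ (Fin m) := submanifoldField (m := m) ι y
    have h3 := congrArg (fun L : _ →L[ℝ] ℝ ↦ L v) (h1.unique h2)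
    have h4 : ∀ {f : Y → ℝ}, ContMDiff (𝓡 m) 𝓘(ℝ, ℝ) ∞ f →
        differential m f y (submanifoldField ι y) = fderiv ℝ (f ∘ e.symm) (e y) v := fun hf ↦ by
      rw [differential_eq_fderiv_chartAt (hf.mdifferentiableAt (by simp))]
      rfl
    rw [h4 hφ, Finset.sum_congr rfl fun i _ ↦ h4 (hψs i)]
    simpa [hye] using h3
  have htot := Finset.sum_nonpos fun i (_ : i ∈ I) ↦ hle i
  rw [Finset.sum_add_distrib, ← Finset.mul_sum, ← integral_finsetSum _ fun i _ ↦ hint1 i,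
    ← integral_finsetSum _ fun i _ ↦ hint2 i] at htot
  simp only [hsum, hdsum] at htot
  rw [integral_neg]
  linarith

/-- The Rayleigh quotient bound for smooth functions with compact support. -/
theorem ofReal_mul_lintegral_sq_le [SecondCountableTopology Y] (hι : IsIsometricImmersion m ι)
    (hα : α < m - 1) (hH : ∀ y : Y, hypNorm (ι y) (meanCurvature m ι y) ≤ α) {φ : Y → ℝ}
    (hφ : ContMDiff (𝓡 m) 𝓘(ℝ, ℝ) ∞ φ) (hc : HasCompactSupport φ) :
    ENNReal.ofReal (((m - 1 - α) / 2) ^ 2) * ∫⁻ y, ‖φ y‖ₑ ^ 2 ∂(riemannianVolume m Y) ≤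
      ∫⁻ y, ‖differential m φ y‖ₑ ^ 2 ∂(riemannianVolume m Y) := by
  have := hι.isLocallyFiniteMeasure_riemannianVolume
  have := ChartedSpace.locallyCompactSpace (EuclideanSpace ℝ (Fin m)) Y
  set c := (m - 1 - α) / 2 with hcdef
  have hc0 : 0 < c := by rw [hcdef]; linarith
  set X : Y → ℝ := fun y ↦ differential m φ y (submanifoldField ι y) with hX
  have hXc : Continuous X := hι.continuous_differential_submanifoldField hφ
  have hX0 : ∀ y, y ∉ tsupport φ → X y = 0 := fun y hy ↦ by
    rw [hX]
    beta_reduce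
    rw [differential_eq_zero_of_notMem_tsupport hy]
    rfl
  have hi1 : Integrable (fun y ↦ φ y ^ 2) (riemannianVolume m Y) :=
    (hφ.continuous.pow 2).integrable_of_hasCompactSupport
      (HasCompactSupport.intro hc.isCompact fun y hy ↦ by
        simp [image_eq_zero_of_notMem_tsupport hy])
  have hi2 : Integrable (fun y ↦ X y ^ 2) (riemannianVolume m Y) :=
    (hXc.pow 2).integrable_of_hasCompactSupport
      (HasCompactSupport.intro hc.isCompact fun y hy ↦ by simp [hX0 y hy])
  have hi3 : Integrable (fun y ↦ -(2 * φ y * X y)) (riemannianVolume m Y) :=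
    ((continuous_const.mul hφ.continuous).mul hXc).neg.integrable_of_hasCompactSupport
      (HasCompactSupport.intro hc.isCompact fun y hy ↦ by simp [hX0 y hy])
  -- `-2 φ X ≤ c φ² + X² / c`, which optimizes the Cauchy-Schwarz inequality
  have hmain : c ^ 2 * ∫ y, φ y ^ 2 ∂(riemannianVolume m Y) ≤
      ∫ y, X y ^ 2 ∂(riemannianVolume m Y) := by
    have h1 := hι.integral_sq_le_integral_differential hH hφ hc
    have h2 : ∫ y, -(2 * φ y * X y) ∂(riemannianVolume m Y) ≤
        ∫ y, (c * φ y ^ 2 + c⁻¹ * X y ^ 2) ∂(riemannianVolume m Y) := by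
      refine integral_mono hi3 ((hi1.const_mul _).add (hi2.const_mul _)) fun y ↦ ?_
      have : c * φ y ^ 2 + c⁻¹ * X y ^ 2 + 2 * φ y * X y = c⁻¹ * (c * φ y + X y) ^ 2 := by
        field_simp
        ring
      have h0 : 0 ≤ c⁻¹ * (c * φ y + X y) ^ 2 := by positivity
      beta_reduce
      linarith
    rw [integral_add (hi1.const_mul _) (hi2.const_mul _), integral_const_mul,
      integral_const_mul] at h2
    have h3 : c * ∫ y, φ y ^ 2 ∂(riemannianVolume m Y) ≤
        c⁻¹ * ∫ y, X y ^ 2 ∂(riemannianVolume m Y) := by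
      have h4 : (m - 1 - α : ℝ) = 2 * c := by rw [hcdef]; ring
      rw [h4] at h1
      have := h1.trans h2
      linarith
    have h5 := mul_le_mul_of_nonneg_left h3 hc0.le
    rwa [← mul_assoc, ← mul_assoc, mul_inv_cancel₀ hc0.ne', one_mul, ← sq] at h5
  have hsq : ∀ t : ℝ, ‖t‖ₑ ^ 2 = ENNReal.ofReal (t ^ 2) := fun t ↦ by
    rw [← ofReal_norm, ← ENNReal.ofReal_pow (norm_nonneg _), Real.norm_eq_abs, sq_abs]
  calc ENNReal.ofReal (c ^ 2) * ∫⁻ y, ‖φ y‖ₑ ^ 2 ∂(riemannianVolume m Y)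
      = ENNReal.ofReal (c ^ 2 * ∫ y, φ y ^ 2 ∂(riemannianVolume m Y)) := by
        simp only [hsq]
        rw [ENNReal.ofReal_mul (sq_nonneg _),
          ofReal_integral_eq_lintegral_ofReal hi1 (ae_of_all _ fun y ↦ sq_nonneg _)]
    _ ≤ ENNReal.ofReal (∫ y, X y ^ 2 ∂(riemannianVolume m Y)) := ENNReal.ofReal_le_ofReal hmain
    _ = ∫⁻ y, ‖X y‖ₑ ^ 2 ∂(riemannianVolume m Y) := by
        simp only [hsq]
        rw [ofReal_integral_eq_lintegral_ofReal hi2 (ae_of_all _ fun y ↦ sq_nonneg _)]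
    _ ≤ ∫⁻ y, ‖differential m φ y‖ₑ ^ 2 ∂(riemannianVolume m Y) := by
        refine lintegral_mono fun y ↦ ?_
        beta_reduce
        gcongr
        rw [enorm_le_iff_norm_le]
        exact ((differential m φ y).le_opNorm _).trans
          (mul_le_of_le_one_right (norm_nonneg _) (hι.norm_submanifoldField_le_one y))

end IsIsometricImmersion

end SpectralBound

/-! ### Passage to the completion -/

section Completion

/-- Minkowski's inequality in `L²`, for nonnegative functions. -/
theorem lintegral_sq_rpow_half_le_add {X : Type*} [MeasurableSpace X] {μ : Measure X}
    {a b c : X → ℝ≥0∞} (ha : AEMeasurable a μ) (hb : AEMeasurable b μ) (hc : ∀ x, c x ≤ a x + b x) :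
    (∫⁻ x, c x ^ 2 ∂μ) ^ (1 / 2 : ℝ) ≤
      (∫⁻ x, a x ^ 2 ∂μ) ^ (1 / 2 : ℝ) + (∫⁻ x, b x ^ 2 ∂μ) ^ (1 / 2 : ℝ) := by
  have h := ENNReal.lintegral_Lp_add_le ha hb one_le_two
  simp only [ENNReal.rpow_two, Pi.add_apply] at h
  refine le_trans ?_ h
  gcongr with x
  exact hc x

theorem enorm_le_enorm_add_enorm_sub {E : Type*} [SeminormedAddCommGroup E] (a b : E) :
    ‖a‖ₑ ≤ ‖b‖ₑ + ‖a - b‖ₑ := by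
  rw [← ofReal_norm, ← ofReal_norm, ← ofReal_norm, ← ENNReal.ofReal_add (norm_nonneg _)
    (norm_nonneg _)]
  exact ENNReal.ofReal_le_ofReal (norm_le_norm_add_norm_sub' a b)

variable {m : ℕ} {Y : Type*} [EMetricSpace Y] [ChartedSpace (EuclideanSpace ℝ (Fin m)) Y]
  [RiemannianBundle (fun y : Y ↦ TangentSpace (𝓡 m) y)] [MeasurableSpace Y] [BorelSpace Y]

/-- A Poincaré inequality for smooth functions with compact support passes to the completion. -/
theorem IsSobolevZero.mul_lintegral_sq_le {Ω : Set Y} (hΩ : IsOpen Ω) {C : ℝ≥0∞} (hC : C ≠ ⊤)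
    (hsmooth : ∀ φ : Y → ℝ, ContMDiff (𝓡 m) 𝓘(ℝ, ℝ) ∞ φ → HasCompactSupport φ →
      C * ∫⁻ y, ‖φ y‖ₑ ^ 2 ∂(riemannianVolume m Y) ≤
        ∫⁻ y, ‖differential m φ y‖ₑ ^ 2 ∂(riemannianVolume m Y))
    {f : Y → ℝ} {G : ∀ y : Y, TangentSpace (𝓡 m) y →L[ℝ] ℝ} (hf : IsSobolevZero Ω f G) :
    C * ∫⁻ y in Ω, ‖f y‖ₑ ^ 2 ∂(riemannianVolume m Y) ≤
      ∫⁻ y in Ω, ‖G y‖ₑ ^ 2 ∂(riemannianVolume m Y) := by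
  obtain ⟨φ, hφ, hlim⟩ := hf.approx
  set μ := (riemannianVolume m Y).restrict Ω with hμ
  have hmeas : ∀ ψ : Y → ℝ, ContMDiff (𝓡 m) 𝓘(ℝ, ℝ) ∞ ψ →
      AEMeasurable (fun y ↦ ‖differential m ψ y - G y‖ₑ) μ := fun ψ hψ ↦ by
    refine (hf.measurable ψ hψ).ennreal_ofReal.congr (ae_of_all _ fun y ↦ ?_)
    exact ofReal_norm (E := TangentSpace (𝓡 m) y →L[ℝ] ℝ) _
  -- `|G| = |d0 - G|`
  have hG : AEMeasurable (fun y ↦ ‖G y‖ₑ) μ := by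
    have h0 : ∀ y : Y, differential m (fun _ : Y ↦ (0 : ℝ)) y = 0 := fun y ↦ mfderiv_const
    refine (hmeas (fun _ ↦ 0) contMDiff_const).congr (ae_of_all _ fun y ↦ ?_)
    beta_reduce
    rw [h0 y, zero_sub]
    exact enorm_neg (E := TangentSpace (𝓡 m) y →L[ℝ] ℝ) _
  set A : ℕ → ℝ≥0∞ := fun j ↦ ∫⁻ y, ‖φ j y - f y‖ₑ ^ 2 ∂μ with hA
  set B : ℕ → ℝ≥0∞ := fun j ↦ ∫⁻ y, ‖differential m (φ j) y - G y‖ₑ ^ 2 ∂μ with hB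
  have hAlim : Tendsto A atTop (𝓝 0) :=
    tendsto_of_tendsto_of_tendsto_of_le_of_le tendsto_const_nhds hlim (fun _ ↦ zero_le)
      fun j ↦ le_self_add
  have hBlim : Tendsto B atTop (𝓝 0) :=
    tendsto_of_tendsto_of_tendsto_of_le_of_le tendsto_const_nhds hlim (fun _ ↦ zero_le)
      fun j ↦ le_add_self
  have hhalf : (0 : ℝ) < 1 / 2 := by norm_num
  have hsq : ∀ {u : ℕ → ℝ≥0∞}, Tendsto u atTop (𝓝 0) →
      Tendsto (fun j ↦ u j ^ (1 / 2 : ℝ)) atTop (𝓝 0) := fun hu ↦ by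
    have := (ENNReal.continuous_rpow_const (y := (1 / 2 : ℝ))).tendsto 0 |>.comp hu
    rwa [ENNReal.zero_rpow_of_pos hhalf] at this
  have hj : ∀ j, (C * ∫⁻ y, ‖f y‖ₑ ^ 2 ∂μ) ^ (1 / 2 : ℝ) ≤
      (∫⁻ y, ‖G y‖ₑ ^ 2 ∂μ) ^ (1 / 2 : ℝ) + B j ^ (1 / 2 : ℝ) +
        C ^ (1 / 2 : ℝ) * A j ^ (1 / 2 : ℝ) := by
    intro j
    have hcont := (hφ j).smooth.continuous
    have h1 : (∫⁻ y, ‖f y‖ₑ ^ 2 ∂μ) ^ (1 / 2 : ℝ) ≤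
        (∫⁻ y, ‖φ j y‖ₑ ^ 2 ∂μ) ^ (1 / 2 : ℝ) + A j ^ (1 / 2 : ℝ) := by
      refine lintegral_sq_rpow_half_le_add hcont.aestronglyMeasurable.enorm
        (hcont.aestronglyMeasurable.sub hf.memLp.aestronglyMeasurable).enorm fun y ↦ ?_
      rw [enorm_sub_rev]
      exact enorm_le_enorm_add_enorm_sub _ _
    have h2 : (∫⁻ y, ‖differential m (φ j) y‖ₑ ^ 2 ∂μ) ^ (1 / 2 : ℝ) ≤
        (∫⁻ y, ‖G y‖ₑ ^ 2 ∂μ) ^ (1 / 2 : ℝ) + B j ^ (1 / 2 : ℝ) := by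
      refine lintegral_sq_rpow_half_le_add hG (hmeas _ (hφ j).smooth) fun y ↦ ?_
      exact enorm_le_enorm_add_enorm_sub (E := TangentSpace (𝓡 m) y →L[ℝ] ℝ) _ _
    have h3 : C * ∫⁻ y, ‖φ j y‖ₑ ^ 2 ∂μ ≤ ∫⁻ y, ‖differential m (φ j) y‖ₑ ^ 2 ∂μ := by
      have hsupp : ∫⁻ y, ‖differential m (φ j) y‖ₑ ^ 2 ∂μ =
          ∫⁻ y, ‖differential m (φ j) y‖ₑ ^ 2 ∂(riemannianVolume m Y) := by
        rw [hμ, ← lintegral_indicator hΩ.measurableSet]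
        refine lintegral_congr fun y ↦ ?_
        by_cases hy : y ∈ Ω
        · rw [indicator_of_mem hy]
        · rw [indicator_of_notMem hy, differential_eq_zero_of_notMem_tsupport fun h ↦
            hy ((hφ j).tsupport_subset h)]
          refine (zero_pow two_ne_zero).symm.trans (congrArg (· ^ 2) ?_)
          exact ((ofReal_norm (E := TangentSpace (𝓡 m) y →L[ℝ] ℝ) 0).symm.trans
            ((congrArg ENNReal.ofReal
              (norm_zero (E := TangentSpace (𝓡 m) y →L[ℝ] ℝ))).trans ENNReal.ofReal_zero)).symm
      rw [hsupp]
      refine le_trans ?_ (hsmooth _ (hφ j).smooth (hφ j).hasCompactSupport)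
      gcongr
      exact Measure.restrict_le_self
    rw [ENNReal.mul_rpow_of_nonneg _ _ hhalf.le]
    calc C ^ (1 / 2 : ℝ) * (∫⁻ y, ‖f y‖ₑ ^ 2 ∂μ) ^ (1 / 2 : ℝ)
        ≤ C ^ (1 / 2 : ℝ) * ((∫⁻ y, ‖φ j y‖ₑ ^ 2 ∂μ) ^ (1 / 2 : ℝ) + A j ^ (1 / 2 : ℝ)) := by gcongr
      _ = (C * ∫⁻ y, ‖φ j y‖ₑ ^ 2 ∂μ) ^ (1 / 2 : ℝ) + C ^ (1 / 2 : ℝ) * A j ^ (1 / 2 : ℝ) := by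
          rw [mul_add, ENNReal.mul_rpow_of_nonneg _ _ hhalf.le]
      _ ≤ (∫⁻ y, ‖differential m (φ j) y‖ₑ ^ 2 ∂μ) ^ (1 / 2 : ℝ) +
            C ^ (1 / 2 : ℝ) * A j ^ (1 / 2 : ℝ) := by gcongr
      _ ≤ _ := by gcongr
  have hlim2 : Tendsto (fun j ↦ (∫⁻ y, ‖G y‖ₑ ^ 2 ∂μ) ^ (1 / 2 : ℝ) + B j ^ (1 / 2 : ℝ) +
      C ^ (1 / 2 : ℝ) * A j ^ (1 / 2 : ℝ)) atTop (𝓝 ((∫⁻ y, ‖G y‖ₑ ^ 2 ∂μ) ^ (1 / 2 : ℝ))) := by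
    have := (tendsto_const_nhds (x := (∫⁻ y, ‖G y‖ₑ ^ 2 ∂μ) ^ (1 / 2 : ℝ))).add (hsq hBlim) |>.add
      (ENNReal.Tendsto.const_mul (hsq hAlim)
        (Or.inr (ENNReal.rpow_ne_top_of_nonneg hhalf.le hC)))
    simpa using this
  exact (ENNReal.rpow_le_rpow_iff hhalf).1 (ge_of_tendsto' hlim2 hj)

end Completion

/-- A complete noncompact submanifold of dimension `k + 1` of `ℍⁿ⁺¹(-1)` with `|H| ≤ α < k` satisfies
`((k - α) / 2)² ≤ λ_{1,2}(Y)`. -/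
theorem mainTheorem11 (n k : ℕ) {Y : Type*} [EMetricSpace Y] [SecondCountableTopology Y]
    [ChartedSpace (EuclideanSpace ℝ (Fin (k + 1))) Y] [IsManifold (𝓡 (k + 1)) ∞ Y]
    [RiemannianBundle (fun y : Y ↦ TangentSpace (𝓡 (k + 1)) y)]
    [IsContMDiffRiemannianBundle (𝓡 (k + 1)) ∞ (EuclideanSpace ℝ (Fin (k + 1)))
      (fun y : Y ↦ TangentSpace (𝓡 (k + 1)) y)]
    [IsRiemannianManifold (𝓡 (k + 1)) Y]
    [CompleteSpace Y] [NoncompactSpace Y] [MeasurableSpace Y] [BorelSpace Y]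
    (ι : Y → EuclideanSpace ℝ (Fin (n + 1))) (hι : IsIsometricImmersion (k + 1) ι)
    (α : ℝ) (hα : α < k)
    (hH : ∀ y : Y, hypNorm (ι y) (meanCurvature (k + 1) ι y) ≤ α) :
    ENNReal.ofReal (((k - α) / 2) ^ 2) ≤ firstDirichletEigenvalue (k + 1) Y := by
  have hk : ((k + 1 : ℕ) : ℝ) - 1 - α = k - α := by push_cast; ring
  refine le_iInf₂ fun Ω hΩ ↦ le_iInf₂ fun f G ↦ le_iInf₂ fun hf hne ↦ ?_
  have h0 : ∫⁻ y in Ω, ‖f y‖ₑ ^ 2 ∂(riemannianVolume (k + 1) Y) ≠ 0 := fun h ↦ hne <| by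
    rw [lintegral_eq_zero_iff' (hf.memLp.aestronglyMeasurable.enorm.pow_const 2)] at h
    filter_upwards [h] with y hy
    simpa using hy
  have htop : ∫⁻ y in Ω, ‖f y‖ₑ ^ 2 ∂(riemannianVolume (k + 1) Y) ≠ ⊤ := by
    have := lintegral_rpow_enorm_lt_top_of_eLpNorm_lt_top two_ne_zero ENNReal.ofNat_ne_top
      hf.memLp.2
    simpa using this.ne
  rw [ENNReal.le_div_iff_mul_le (Or.inl h0) (Or.inl htop)]
  refine hf.mul_lintegral_sq_le hΩ.isOpen ENNReal.ofReal_ne_top fun φ hφ hc ↦ ?_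
  have h := hι.ofReal_mul_lintegral_sq_le (by linarith [hk]) hH hφ hc
  rwa [hk] at h
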